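/- **Notation.** Let $n\ge 1$, $\langle \xi,x\rangle=\sum_j \xi_jx_j$, $|x|=\sum_j|x_j|$, $\|\xi\|=(\sum_j\xi_j^2)^{1/2}$, and write $z=x+iy\in\mathbb C^n$. Let $C\subset\mathbb R^n$ be a nonempty open convex cone with vertex at the origin, with $C\ne\mathbb R$ if $n=1$, and let $C^*=\{\xi:\langle\xi,x\rangle\ge 0\ \forall x\in C\}$. A cone $C'$ is compact in $C$, written $C'\Subset C$, if $\overline{C'}\cap S^{n-1}\subset C\cap S^{n-1}$. Put $T(C';r)=\{z: y\in C',\ |y|>r\}$ and $h_{C^*}(y)=\sup_{\xi\in C^*\cap S^{n-1}}|\langle\xi,y\rangle|$ (with $\sup\emptyset=0$). * $\mathscr U(\mathbb R^n)$, the space of tempered ultrahyperfunctions, is the space of continuous linear functionals on the space $\mathfrak H$ of entire functions $\varphi$ with $\|\varphi\|_{K,N}=\sup_{y\in K}(1+|z|)^N|\varphi(z)|<\infty$ for all convex compact $K\subset\mathbb R^n$ and all $N\in\mathbb N$, topologized by these seminorms. * $\mathscr H^o_c$ is the space of functions $f$ such that for every $C'\Subset C$ there are $r>0$, $M$, $N$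 such that $f$ is holomorphic at the points of $T(C';r)$ and $|f(z)|\le M(1+|z|)^Ne^{h_{C^*}(y)}$ there. * $\Pi$ is the set of pseudo-polynomials, i.e. linear combinations of functions $z_j^sG(z_1,\dots,z_{j-1},z_{j+1},\dots,z_n)$, $s\in\mathbb N$, where $G$ belongs to the space $\mathscr H_\omega$ (in $n-1$ variables): for some $p\in\mathbb N$, $G$ is holomorphic for $|\mathrm{Im}\,z_i|>p$ (all $i$), and $G/\prod_i z_i^p$ is continuous and bounded, and $|G(z)|\le M(1+|z|)^N$ for some $M,N$, for $|\mathrm{Im}\,z_i|\ge p$ (all $i$). $\mathscr U_c=\mathscr H^o_c/\Pi$ is the quotient of $\mathscr H^o_c$ by the functions which agree with a pseudo-polynomial where $|\mathrm{Im}\, z_i|$ is large for all $i$ (for each $C'\Subset C$, on a tube $T(C';r)$). * $T\in\mathscr U(\mathbb R^n)$ is represented by $f\in\mathscr H^o_c$ if for every $C'\Subset C$ there is $r>0$ such that for all $y\in C'$ with $|y|>r$ and all $\varphi\in\mathfrak H$ the integral $\int_{\mathbb R^n}f(x+iy)\varphi(x+iy)\,dx$ converges absolutely and equals $T(\varphi)$.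 * For $O\subset\mathbb R^n$ nonempty, open and convex, $H(\mathbb R^n;O)$ is the space of $C^\infty$ functions $\psi$ such that $e^{h_K(\xi)}D^\alpha\psi(\xi)$, $h_K(\xi)=\sup_{x\in K}|\langle\xi,x\rangle|$, is bounded for all $\alpha$ and all convex compact $K\subset O$, with the topology given by the suprema; $H'_{C^*}(\mathbb R^n;O)$ is the set of continuous linear functionals $V$ on it (distributions of exponential growth) with support in $C^*$. The tempered ultrahyperfunction $T$ associated with $V$ is $T(\varphi)=(2\pi)^{-n}V(\widehat\varphi)$, $\widehat\varphi(\xi)=\int_{\mathbb R^n}\varphi(x)e^{i\langle\xi,x\rangle}dx$; formally $T=(2\pi)^{-n}\int V(\xi)e^{i\langle\xi,z\rangle}d\xi$. * For $T\in\mathscr U(\mathbb R^n)$ the analytic wave front set $WF_A(T)\subset\mathbb R^n\times(\mathbb R^n\setminus\{0\})$ is defined by the FBI transform: $(x_0,\xi_0)\notin WF_A(T)$ if there are $\kappa>0$, a neighbourhood $U$ of $x_0$, an open cone $\Gamma\ni\xi_0$ and $A$, $\varepsilon>0$ with $$\Bigl|T_z\bigl(e^{i\langle x-z,\xi\rangle-\kappa\|\xi\|\sum_j(x_j-z_j)^2}\bigr)\Bigr|\le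 Ae^{-\varepsilon\|\xi\|}\qquad(x\in U,\ \xi\in\Gamma,\ \|\xi\|\ge 1).$$ **Theorem.** (1) Let $u\in\mathscr U_c$ and let $f\in\mathscr H^o_c$ be any representative of the class $u$. Then there is exactly one $T\in\mathscr U(\mathbb R^n)$ represented by $f$, and $WF_A(T)\subset\mathbb R^n\times C^*$. (That is, $WF_A(u)\subset\mathbb R^n\times C^*$, whichever representative is used to compute it.) (2) If $O$ is a nonempty open convex set, $V\in H'_{C^*}(\mathbb R^n;O)$, and $T\in\mathscr U(\mathbb R^n)$ is the tempered ultrahyperfunction associated with $V$, then $WF_A(T)\subset\mathbb R^n\times C^*$. -/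

import Mathlib

open Set Filter Topology MeasureTheory
open scoped ContDiff

noncomputable section

namespace UHF

/-! ### Notation in `ℝⁿ` and `ℂⁿ` -/

/-- The pairing `⟨ξ, x⟩ = ξ₁ x₁ + ⋯ + ξₙ xₙ`. -/
def pair {n : ℕ} (ξ x : Fin n → ℝ) : ℝ := ∑ i, ξ i * x i

/-- The `ℓ¹`-norm `|x| = |x₁| + ⋯ + |xₙ|`, for real or complex coordinates. -/
def l1 {ι 𝕜 : Type*} [Fintype ι] [NormedField 𝕜] (x : ι → 𝕜) : ℝ := ∑ i, ‖x i‖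

/-- The Euclidean length of `ξ`. -/
def euclid {n : ℕ} (ξ : Fin n → ℝ) : ℝ := Real.sqrt (∑ i, ξ i ^ 2)

/-- The unit sphere `S^{n-1}`. -/
def unitSphere (n : ℕ) : Set (Fin n → ℝ) := {ξ | euclid ξ = 1}

/-- The point `x + i y` of `ℂⁿ`. -/
def cpt {n : ℕ} (x y : Fin n → ℝ) : Fin n → ℂ := fun j => (x j : ℂ) + (y j : ℂ) * Complex.I

/-- The imaginary part of a point of `ℂⁿ`. -/
def imPart {n : ℕ} (z : Fin n → ℂ) : Fin n → ℝ := fun j => (z j).im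

lemma l1_nonneg {ι 𝕜 : Type*} [Fintype ι] [NormedField 𝕜] (x : ι → 𝕜) : 0 ≤ l1 x :=
  Finset.sum_nonneg fun _ _ => norm_nonneg _

/-! ### Cones -/

/-- A cone with vertex at the origin: closed under multiplication by positive reals. -/
def IsCone {n : ℕ} (C : Set (Fin n → ℝ)) : Prop :=
  ∀ x ∈ C, ∀ t : ℝ, 0 < t → t • x ∈ C

/-- `C' ⋐ C`: the cone `C'` is compact in `C`, i.e. `pr (closure C') ⊆ pr C`. -/
def IsCompactSubcone {n : ℕ} (C' C : Set (Fin n → ℝ)) : Prop :=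
  IsCone C' ∧ closure C' ∩ unitSphere n ⊆ C ∩ unitSphere n

/-- The dual cone `C* = {ξ | ⟨ξ, x⟩ ≥ 0 for all x ∈ C}`. -/
def dualCone {n : ℕ} (C : Set (Fin n → ℝ)) : Set (Fin n → ℝ) :=
  {ξ | ∀ x ∈ C, 0 ≤ pair ξ x}

/-- The indicator `h_S(y) = sup_{ξ ∈ S} |⟨ξ, y⟩|` of a bounded set `S`. -/
def indicatorFn {n : ℕ} (S : Set (Fin n → ℝ)) (y : Fin n → ℝ) : ℝ :=
  sSup ((fun ξ => |pair ξ y|) '' S)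

/-- The indicator of a cone: the supremum is taken over the projection of the cone to the
unit sphere (over the whole cone it would be infinite). -/
def coneIndicator {n : ℕ} (Γ : Set (Fin n → ℝ)) (y : Fin n → ℝ) : ℝ :=
  indicatorFn (Γ ∩ unitSphere n) y

/-- The tube `T(C'; r) = ℝⁿ + i (C' \ (C' ∩ B[0; r]))`. -/
def tube {n : ℕ} (C' : Set (Fin n → ℝ)) (r : ℝ) : Set (Fin n → ℂ) :=
  {z | imPart z ∈ C' ∧ r < l1 (imPart z)}

/-! ### Test functions and tempered ultrahyperfunctions -/

/-- The compact convex subsets of `O`. -/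
def CompactConvexIn {n : ℕ} (O : Set (Fin n → ℝ)) : Type :=
  {K : Set (Fin n → ℝ) // IsCompact K ∧ Convex ℝ K ∧ K ⊆ O}

/-- The space `𝔥 = 𝔥(T(ℝⁿ))` of entire functions which decrease rapidly in every horizontal
strip `ℝⁿ + iK`, `K` convex and compact. -/
def testSubmodule (n : ℕ) : Submodule ℂ ((Fin n → ℂ) → ℂ) where
  carrier := {φ | Differentiable ℂ φ ∧ ∀ (K : CompactConvexIn (univ : Set (Fin n → ℝ))) (N : ℕ),
    ∃ M : ℝ, ∀ z, imPart z ∈ K.1 → (1 + l1 z) ^ N * ‖φ z‖ ≤ M}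
  add_mem' := by
    rintro φ ψ ⟨hφ, bφ⟩ ⟨hψ, bψ⟩
    refine ⟨hφ.add hψ, fun K N => ?_⟩
    obtain ⟨M₁, h₁⟩ := bφ K N
    obtain ⟨M₂, h₂⟩ := bψ K N
    refine ⟨M₁ + M₂, fun z hz => ?_⟩
    have h0 : 0 ≤ (1 + l1 z) ^ N := pow_nonneg (by linarith [l1_nonneg z]) N
    calc (1 + l1 z) ^ N * ‖(φ + ψ) z‖
        ≤ (1 + l1 z) ^ N * (‖φ z‖ + ‖ψ z‖) :=
          mul_le_mul_of_nonneg_left (norm_add_le _ _) h0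
      _ ≤ M₁ + M₂ := by rw [mul_add]; exact add_le_add (h₁ z hz) (h₂ z hz)
  zero_mem' := ⟨differentiable_const 0, fun _ _ => ⟨0, fun z _ => by simp⟩⟩
  smul_mem' := by
    rintro c φ ⟨hφ, bφ⟩
    refine ⟨hφ.const_smul c, fun K N => ?_⟩
    obtain ⟨M, h⟩ := bφ K N
    refine ⟨‖c‖ * M, fun z hz => ?_⟩
    calc (1 + l1 z) ^ N * ‖(c • φ) z‖ = ‖c‖ * ((1 + l1 z) ^ N * ‖φ z‖) := by
          simp only [Pi.smul_apply, smul_eq_mul, norm_mul]; ring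
      _ ≤ ‖c‖ * M := mul_le_mul_of_nonneg_left (h z hz) (norm_nonneg c)

/-- The space `𝔥`, as a type of its own (it does not carry the topology of pointwise
convergence). -/
def TestSpace (n : ℕ) : Type := testSubmodule n

instance (n : ℕ) : AddCommGroup (TestSpace n) := inferInstanceAs (AddCommGroup (testSubmodule n))

instance (n : ℕ) : Module ℂ (TestSpace n) := inferInstanceAs (Module ℂ (testSubmodule n))

/-- The entire function underlying an element of `𝔥`. -/
def TestSpace.fn {n : ℕ} : TestSpace n → (Fin n → ℂ) → ℂ := fun φ => Subtype.val φ

lemma TestSpace.mem {n : ℕ} (φ : TestSpace n) : φ.fn ∈ testSubmodule n := Subtype.property φ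

/-- An element of `𝔥` from a function with the required properties. -/
def TestSpace.mk {n : ℕ} (φ : (Fin n → ℂ) → ℂ) (hφ : φ ∈ testSubmodule n) : TestSpace n :=
  Subtype.mk φ hφ

/-- A seminorm from a family of pointwise weighted norms `q z φ` with finite suprema. -/
def supSeminorm {E X : Type*} [AddCommGroup E] [Module ℂ E] (q : X → Seminorm ℂ E)
    (hq : ∀ φ, BddAbove (range fun z => q z φ)) : Seminorm ℂ E :=
  Seminorm.of (fun φ => ⨆ z, q z φ)
    (fun φ ψ => by
      rcases isEmpty_or_nonempty X with hX | hX
      · simp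
      · exact ciSup_le fun z => (map_add_le_add (q z) φ ψ).trans
          (add_le_add (le_ciSup (hq φ) z) (le_ciSup (hq ψ) z)))
    (fun c φ => by
      simp only [map_smul_eq_mul]
      exact (Real.mul_iSup_of_nonneg (norm_nonneg c) _).symm)

/-- The weighted evaluation `φ ↦ (1 + |z|)^N |φ(z)|`. -/
def testEval {n : ℕ} (N : ℕ) (z : Fin n → ℂ) : Seminorm ℂ (TestSpace n) :=
  Seminorm.of (fun φ => (1 + l1 z) ^ N * ‖φ.fn z‖)
    (fun φ ψ => by
      have h0 : 0 ≤ (1 + l1 z) ^ N := pow_nonneg (by linarith [l1_nonneg z]) N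
      rw [← mul_add]
      exact mul_le_mul_of_nonneg_left (norm_add_le _ _) h0)
    (fun c φ => by
      change (1 + l1 z) ^ N * ‖c * φ.fn z‖ = _
      rw [norm_mul]; ring)

/-- The seminorms `‖φ‖_{K,N} = sup_{z ∈ T(K)} (1 + |z|)^N |φ(z)|` on `𝔥`. -/
def testSeminorm (n : ℕ) :
    SeminormFamily ℂ (TestSpace n) (CompactConvexIn (univ : Set (Fin n → ℝ)) × ℕ) :=
  fun i => supSeminorm (fun z : {z : Fin n → ℂ // imPart z ∈ i.1.1} => testEval i.2 z.1)
    (fun φ => by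
      obtain ⟨M, hM⟩ := φ.mem.2 i.1 i.2
      refine ⟨M, ?_⟩
      rintro _ ⟨z, rfl⟩
      exact hM z.1 z.2)

instance {n : ℕ} (O : Set (Fin n → ℝ)) : Nonempty (CompactConvexIn O) :=
  ⟨⟨∅, isCompact_empty, convex_empty, empty_subset O⟩⟩

/-- The projective limit topology of `𝔥`. -/
instance (n : ℕ) : TopologicalSpace (TestSpace n) := (testSeminorm n).moduleFilterBasis.topology

/-- The space `𝒰(ℝⁿ)` of tempered ultrahyperfunctions: continuous linear functionals on `𝔥`. -/
abbrev TemperedUltrahyperfunction (n : ℕ) : Type := TestSpace n →L[ℂ] ℂ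

/-! ### The analytic wave front set -/

/-- The wave packet `z ↦ exp (i ⟨x - z, ξ⟩ - c ∑ (xⱼ - zⱼ)²)`. -/
def packetFun {n : ℕ} (c : ℝ) (x ξ : Fin n → ℝ) (z : Fin n → ℂ) : ℂ :=
  Complex.exp (∑ j, (Complex.I * (((x j : ℂ) - z j) * (ξ j : ℂ)) - (c : ℂ) * ((x j : ℂ) - z j) ^ 2))

lemma packet_re_bound (c a B t y ξ : ℝ) (hc : 0 < c) (hy : |y| ≤ B) :
    |t| + |y| + (y * ξ - c * ((a - t) ^ 2 - y ^ 2))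
      ≤ |a| + 1 / (4 * c) + B + B * |ξ| + c * B ^ 2 := by
  have h1 : |t| ≤ |a| + |a - t| := by
    have := abs_sub_abs_le_abs_sub t a
    rw [abs_sub_comm t a] at this
    linarith
  have h2 : |a - t| - c * (a - t) ^ 2 ≤ 1 / (4 * c) := by
    rw [le_div_iff₀ (by positivity), ← sq_abs (a - t)]
    nlinarith [sq_nonneg (2 * c * |a - t| - 1)]
  have h3 : y * ξ ≤ B * |ξ| := by
    calc y * ξ ≤ |y * ξ| := le_abs_self _
      _ = |y| * |ξ| := abs_mul _ _
      _ ≤ B * |ξ| := mul_le_mul_of_nonneg_right hy (abs_nonneg _)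
  have h4 : y ^ 2 ≤ B ^ 2 := by
    rw [← sq_abs y]; exact pow_le_pow_left₀ (abs_nonneg _) hy 2
  nlinarith [mul_le_mul_of_nonneg_left h4 hc.le]

lemma packet_mem {n : ℕ} (c : ℝ) (hc : 0 < c) (x ξ : Fin n → ℝ) :
    packetFun c x ξ ∈ testSubmodule n := by
  refine ⟨?_, fun K N => ?_⟩
  · unfold packetFun; fun_prop
  · obtain ⟨B, hB⟩ := K.2.1.isBounded.exists_norm_le
    set R : ℝ := ∑ j, (|x j| + 1 / (4 * c) + B + B * |ξ j| + c * B ^ 2) with hR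
    refine ⟨(N.factorial : ℝ) * Real.exp (1 + R), fun z hz => ?_⟩
    have hy : ∀ j, |(z j).im| ≤ B := fun j =>
      (norm_le_pi_norm (imPart z) j).trans (hB _ hz)
    have hl : 0 ≤ 1 + l1 z := by linarith [l1_nonneg z]
    have hpow : (1 + l1 z) ^ N ≤ (N.factorial : ℝ) * Real.exp (1 + l1 z) := by
      have := Real.pow_div_factorial_le_exp (1 + l1 z) hl N
      rwa [div_le_iff₀ (by positivity), mul_comm] at this
    have hnorm : ‖packetFun c x ξ z‖ =
        Real.exp (∑ j, ((z j).im * ξ j - c * ((x j - (z j).re) ^ 2 - (z j).im ^ 2))) := by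
      rw [packetFun, Complex.norm_exp, Complex.re_sum]
      congr 1
      refine Finset.sum_congr rfl fun j _ => ?_
      simp [pow_two]
    have hsum : l1 z + ∑ j, ((z j).im * ξ j - c * ((x j - (z j).re) ^ 2 - (z j).im ^ 2)) ≤ R := by
      rw [l1, ← Finset.sum_add_distrib]
      refine Finset.sum_le_sum fun j _ => ?_
      have h1 := Complex.norm_le_abs_re_add_abs_im (z j)
      have h2 := packet_re_bound c (x j) B (z j).re (z j).im (ξ j) hc (hy j)
      linarith
    rw [hnorm]
    calc (1 + l1 z) ^ N * Real.exp _
        ≤ (N.factorial : ℝ) * Real.exp (1 + l1 z) * Real.exp _ :=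
          mul_le_mul_of_nonneg_right hpow (Real.exp_pos _).le
      _ ≤ (N.factorial : ℝ) * Real.exp (1 + R) := by
          rw [mul_assoc, ← Real.exp_add]
          refine mul_le_mul_of_nonneg_left (Real.exp_le_exp.2 ?_) (by positivity)
          linarith

/-- The wave packet as a test function. -/
def packet {n : ℕ} (c : ℝ) (hc : 0 < c) (x ξ : Fin n → ℝ) : TestSpace n :=
  TestSpace.mk (packetFun c x ξ) (packet_mem c hc x ξ)

/-- The Fourier–Bros–Iagolnitzer transform
`F_κ T (x, ξ) = T_z (exp (i ⟨x - z, ξ⟩ - κ |ξ| (x - z)²))`, with the Euclidean length `|ξ|`. -/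
def fbi {n : ℕ} (T : TemperedUltrahyperfunction n) (κ : ℝ) (x ξ : Fin n → ℝ)
    (h : 0 < κ * euclid ξ) : ℂ :=
  T (packet (κ * euclid ξ) h x ξ)

/-- `T` is microlocally analytic at `(x₀, ξ₀)`: for some `κ > 0` its FBI transform decreases
exponentially as `|ξ| → ∞`, uniformly for `x` near `x₀` and `ξ` in a conic neighbourhood
of `ξ₀`. -/
def MicroAnalyticAt {n : ℕ} (T : TemperedUltrahyperfunction n) (x₀ ξ₀ : Fin n → ℝ) : Prop :=
  ∃ κ : ℝ, 0 < κ ∧ ∃ U ∈ 𝓝 x₀, ∃ Γ : Set (Fin n → ℝ), IsOpen Γ ∧ IsCone Γ ∧ ξ₀ ∈ Γ ∧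
    ∃ A ε : ℝ, 0 < ε ∧ ∀ x ∈ U, ∀ ξ ∈ Γ, 1 ≤ euclid ξ →
      ∀ h : 0 < κ * euclid ξ, ‖fbi T κ x ξ h‖ ≤ A * Real.exp (-ε * euclid ξ)

/-- The analytic wave front set `WF_A(T) ⊆ ℝⁿ × (ℝⁿ \ 0)`. -/
def analyticWF {n : ℕ} (T : TemperedUltrahyperfunction n) : Set ((Fin n → ℝ) × (Fin n → ℝ)) :=
  {p | p.2 ≠ 0 ∧ ¬ MicroAnalyticAt T p.1 p.2}

/-! ### The space `ℋ°_c`, pseudo-polynomials and the quotient `𝒰_c` -/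

/-- The space `ℋ°_c`: functions holomorphic in the tubes `T(C'; r)`, for every compact subcone
`C'` of `C` and some `r > 0`, with `|f(z)| ≤ M (1 + |z|)^N exp (h_{C*}(y))` there. Values outside
these tubes carry no information (they are divided out in `UCone`). -/
def HoloSpace {n : ℕ} (C : Set (Fin n → ℝ)) : Submodule ℂ ((Fin n → ℂ) → ℂ) where
  carrier := {f | ∀ C', IsCompactSubcone C' C → ∃ r : ℝ, 0 < r ∧
    (∀ z ∈ tube C' r, DifferentiableAt ℂ f z) ∧
    ∃ (M : ℝ) (N : ℕ), ∀ z ∈ tube C' r,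
      ‖f z‖ ≤ M * (1 + l1 z) ^ N * Real.exp (coneIndicator (dualCone C) (imPart z))}
  add_mem' := by
    intro f g hf hg C' hC'
    obtain ⟨r, hr, hd, M, N, hb⟩ := hf C' hC'
    obtain ⟨s, hs, hd', M', N', hb'⟩ := hg C' hC'
    have hsub : ∀ z ∈ tube C' (max r s), z ∈ tube C' r ∧ z ∈ tube C' s := fun z hz =>
      ⟨⟨hz.1, (le_max_left r s).trans_lt hz.2⟩, ⟨hz.1, (le_max_right r s).trans_lt hz.2⟩⟩
    refine ⟨max r s, lt_max_of_lt_left hr,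
      fun z hz => (hd z (hsub z hz).1).add (hd' z (hsub z hz).2),
      |M| + |M'|, N + N', fun z hz => ?_⟩
    have h1 : 1 ≤ 1 + l1 z := by linarith [l1_nonneg z]
    have e0 := (Real.exp_pos (coneIndicator (dualCone C) (imPart z))).le
    have key : ∀ (M : ℝ) (k : ℕ), k ≤ N + N' →
        M * (1 + l1 z) ^ k * Real.exp (coneIndicator (dualCone C) (imPart z)) ≤
        |M| * (1 + l1 z) ^ (N + N') * Real.exp (coneIndicator (dualCone C) (imPart z)) := by
      intro M k hk
      refine mul_le_mul_of_nonneg_right ?_ e0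
      exact mul_le_mul (le_abs_self M) (pow_le_pow_right₀ h1 hk)
        (pow_nonneg (by linarith) _) (abs_nonneg M)
    calc ‖(f + g) z‖ ≤ ‖f z‖ + ‖g z‖ := norm_add_le _ _
      _ ≤ _ := add_le_add ((hb z (hsub z hz).1).trans (key M N (Nat.le_add_right _ _)))
            ((hb' z (hsub z hz).2).trans (key M' N' (Nat.le_add_left _ _)))
      _ = _ := by ring
  zero_mem' := fun _ _ => ⟨1, one_pos, fun _ _ => differentiableAt_const 0, 0, 0,
    fun _ _ => by simp⟩
  smul_mem' := by
    intro c f hf C' hC'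
    obtain ⟨r, hr, hd, M, N, hb⟩ := hf C' hC'
    refine ⟨r, hr, fun z hz => (hd z hz).const_smul c, ‖c‖ * M, N, fun z hz => ?_⟩
    calc ‖(c • f) z‖ = ‖c‖ * ‖f z‖ := by simp
      _ ≤ ‖c‖ * (M * (1 + l1 z) ^ N * Real.exp (coneIndicator (dualCone C) (imPart z))) :=
        mul_le_mul_of_nonneg_left (hb z hz) (norm_nonneg c)
      _ = _ := by ring

/-- The space `ℋ_ω` in the variables indexed by `ι`. -/
def HOmega {ι : Type*} [Fintype ι] (f : (ι → ℂ) → ℂ) : Prop :=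
  ∃ p : ℕ,
    DifferentiableOn ℂ f {z | ∀ i, (p : ℝ) < |(z i).im|} ∧
    ContinuousOn (fun z => f z / ∏ i, z i ^ p) {z | ∀ i, (p : ℝ) ≤ |(z i).im|} ∧
    (∃ M : ℝ, ∀ z : ι → ℂ, (∀ i, (p : ℝ) ≤ |(z i).im|) → ‖f z / ∏ i, z i ^ p‖ ≤ M) ∧
    ∃ (M : ℝ) (N : ℕ), ∀ z : ι → ℂ, (∀ i, (p : ℝ) ≤ |(z i).im|) → ‖f z‖ ≤ M * (1 + l1 z) ^ N

/-- The set `Π` of pseudo-polynomials: linear combinations of functions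
`z_j^s G(z_1, …, z_{j-1}, z_{j+1}, …, z_n)` with `G ∈ ℋ_ω`. -/
def pseudoPolynomials (n : ℕ) : Submodule ℂ ((Fin n → ℂ) → ℂ) :=
  Submodule.span ℂ {P | ∃ (j : Fin n) (s : ℕ) (G : ({i : Fin n // i ≠ j} → ℂ) → ℂ),
    HOmega G ∧ P = fun z => z j ^ s * G (fun i => z i.1)}

/-- The elements of `ℋ°_c` which agree with a pseudo-polynomial where both are defined. -/
def pseudoPart {n : ℕ} (C : Set (Fin n → ℝ)) : Submodule ℂ (HoloSpace C) where
  carrier := {f | ∃ P ∈ pseudoPolynomials n, ∃ p : ℝ, ∀ C', IsCompactSubcone C' C →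
    ∃ r : ℝ, 0 < r ∧ ∀ z ∈ tube C' r, (∀ i, p < |(z i).im|) → f.1 z = P z}
  add_mem' := by
    rintro f g ⟨P, hP, p, h⟩ ⟨Q, hQ, q, h'⟩
    refine ⟨P + Q, Submodule.add_mem _ hP hQ, max p q, fun C' hC' => ?_⟩
    obtain ⟨r, hr, hh⟩ := h C' hC'
    obtain ⟨s, hs, hh'⟩ := h' C' hC'
    refine ⟨max r s, lt_max_of_lt_left hr, fun z hz hi => ?_⟩
    have e1 := hh z ⟨hz.1, (le_max_left r s).trans_lt hz.2⟩
      fun i => (le_max_left p q).trans_lt (hi i)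
    have e2 := hh' z ⟨hz.1, (le_max_right r s).trans_lt hz.2⟩
      fun i => (le_max_right p q).trans_lt (hi i)
    simp only [Submodule.coe_add, Pi.add_apply, e1, e2]
  zero_mem' := ⟨0, Submodule.zero_mem _, 0, fun _ _ => ⟨1, one_pos, fun _ _ _ => rfl⟩⟩
  smul_mem' := by
    rintro c f ⟨P, hP, p, h⟩
    refine ⟨c • P, Submodule.smul_mem _ c hP, p, fun C' hC' => ?_⟩
    obtain ⟨r, hr, hh⟩ := h C' hC'
    refine ⟨r, hr, fun z hz hi => ?_⟩
    simp only [Submodule.coe_smul, Pi.smul_apply, hh z hz hi]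

/-- The space `𝒰_c = ℋ°_c / Π`. -/
abbrev UCone {n : ℕ} (C : Set (Fin n → ℝ)) : Type := HoloSpace C ⧸ pseudoPart C

/-- `T` is the tempered ultrahyperfunction given by the holomorphic function `f`:
`T(φ) = ∫_{ℝⁿ + iy} f(z) φ(z) dz` for every `y` in a compact subcone of `C`, `|y|` large. -/
def Represents {n : ℕ} (C : Set (Fin n → ℝ)) (f : (Fin n → ℂ) → ℂ)
    (T : TemperedUltrahyperfunction n) : Prop :=
  ∀ C', IsCompactSubcone C' C → ∃ r : ℝ, 0 < r ∧ ∀ y ∈ C', r < l1 y → ∀ φ : TestSpace n,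
    Integrable (fun x : Fin n → ℝ => f (cpt x y) * φ.fn (cpt x y)) ∧
    T φ = ∫ x : Fin n → ℝ, f (cpt x y) * φ.fn (cpt x y)

/-! ### Distributions of exponential growth -/

/-- The space `H(ℝⁿ; O)` of smooth functions `f` for which `exp (h_K(ξ)) D^α f(ξ)` is bounded for
every convex compact `K ⊆ O` and every order of differentiation. -/
def expSubmodule {n : ℕ} (O : Set (Fin n → ℝ)) : Submodule ℂ ((Fin n → ℝ) → ℂ) where
  carrier := {f | ContDiff ℝ ∞ f ∧ ∀ (K : CompactConvexIn O) (m : ℕ), ∃ M : ℝ, ∀ ξ,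
    Real.exp (indicatorFn K.1 ξ) * ‖iteratedFDeriv ℝ m f ξ‖ ≤ M}
  add_mem' := by
    rintro f g ⟨hf, bf⟩ ⟨hg, bg⟩
    refine ⟨hf.add hg, fun K m => ?_⟩
    obtain ⟨M₁, h₁⟩ := bf K m
    obtain ⟨M₂, h₂⟩ := bg K m
    refine ⟨M₁ + M₂, fun ξ => ?_⟩
    rw [iteratedFDeriv_add_apply (hf.contDiffAt.of_le (by exact_mod_cast le_top))
      (hg.contDiffAt.of_le (by exact_mod_cast le_top))]
    refine (mul_le_mul_of_nonneg_left (norm_add_le _ _) (Real.exp_pos _).le).trans ?_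
    rw [mul_add]
    exact add_le_add (h₁ ξ) (h₂ ξ)
  zero_mem' := ⟨contDiff_const, fun _ m => ⟨0, fun ξ => by
    simp [show (0 : (Fin n → ℝ) → ℂ) = fun _ => 0 from rfl]⟩⟩
  smul_mem' := by
    rintro c f ⟨hf, bf⟩
    refine ⟨hf.const_smul c, fun K m => ?_⟩
    obtain ⟨M, h⟩ := bf K m
    refine ⟨‖c‖ * M, fun ξ => ?_⟩
    rw [iteratedFDeriv_const_smul_apply (hf.contDiffAt.of_le (by exact_mod_cast le_top)),
      norm_smul, mul_left_comm]
    exact mul_le_mul_of_nonneg_left (h ξ) (norm_nonneg c)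

/-- The space `H(ℝⁿ; O)`, as a type of its own. -/
def ExpSpace {n : ℕ} (O : Set (Fin n → ℝ)) : Type := expSubmodule O

instance {n : ℕ} (O : Set (Fin n → ℝ)) : AddCommGroup (ExpSpace O) :=
  inferInstanceAs (AddCommGroup (expSubmodule O))

instance {n : ℕ} (O : Set (Fin n → ℝ)) : Module ℂ (ExpSpace O) :=
  inferInstanceAs (Module ℂ (expSubmodule O))

/-- The smooth function underlying an element of `H(ℝⁿ; O)`. -/
def ExpSpace.fn {n : ℕ} {O : Set (Fin n → ℝ)} : ExpSpace O → (Fin n → ℝ) → ℂ :=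
  fun f => Subtype.val f

lemma ExpSpace.mem {n : ℕ} {O : Set (Fin n → ℝ)} (f : ExpSpace O) : f.fn ∈ expSubmodule O :=
  Subtype.property f

/-- The weighted evaluation `f ↦ exp (h_K(ξ)) ‖D^m f(ξ)‖`. -/
def expEval {n : ℕ} {O : Set (Fin n → ℝ)} (K : CompactConvexIn O) (m : ℕ) (ξ : Fin n → ℝ) :
    Seminorm ℂ (ExpSpace O) :=
  Seminorm.of (fun f => Real.exp (indicatorFn K.1 ξ) * ‖iteratedFDeriv ℝ m f.fn ξ‖)
    (fun f g => by
      change _ * ‖iteratedFDeriv ℝ m (f.fn + g.fn) ξ‖ ≤ _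
      rw [iteratedFDeriv_add_apply
        (f.mem.1.contDiffAt.of_le (by exact_mod_cast le_top))
        (g.mem.1.contDiffAt.of_le (by exact_mod_cast le_top)), ← mul_add]
      exact mul_le_mul_of_nonneg_left (norm_add_le _ _) (Real.exp_pos _).le)
    (fun c f => by
      change _ * ‖iteratedFDeriv ℝ m (c • f.fn) ξ‖ = _
      rw [iteratedFDeriv_const_smul_apply
        (f.mem.1.contDiffAt.of_le (by exact_mod_cast le_top)), norm_smul, mul_left_comm])

/-- The seminorms `sup_ξ exp (h_K(ξ)) ‖D^m f(ξ)‖` on `H(ℝⁿ; O)`. -/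
def expSeminorm {n : ℕ} (O : Set (Fin n → ℝ)) :
    SeminormFamily ℂ (ExpSpace O) (CompactConvexIn O × ℕ) :=
  fun i => supSeminorm (fun ξ => expEval i.1 i.2 ξ)
    (fun f => by
      obtain ⟨M, hM⟩ := f.mem.2 i.1 i.2
      refine ⟨M, ?_⟩
      rintro _ ⟨ξ, rfl⟩
      exact hM ξ)

/-- The projective limit topology of `H(ℝⁿ; O)`. -/
instance {n : ℕ} (O : Set (Fin n → ℝ)) : TopologicalSpace (ExpSpace O) :=
  (expSeminorm O).moduleFilterBasis.topology

/-- The space `H'_{C*}(ℝⁿ; O)` of distributions of exponential growth `V ∈ H'(ℝⁿ; O)` with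
`supp V ⊆ C*`. -/
def ExpDualCone {n : ℕ} (O C : Set (Fin n → ℝ)) : Set (ExpSpace O →L[ℂ] ℂ) :=
  {V | ∀ φ : ExpSpace O, HasCompactSupport φ.fn → Disjoint (tsupport φ.fn) (dualCone C) → V φ = 0}

/-- The Fourier transform `ξ ↦ ∫ φ(x) e^{i⟨ξ,x⟩} dx` of a function on `ℝⁿ`. -/
def fourier {n : ℕ} (φ : (Fin n → ℝ) → ℂ) (ξ : Fin n → ℝ) : ℂ :=
  ∫ x : Fin n → ℝ, φ x * Complex.exp (Complex.I * (pair ξ x : ℂ))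

/-- `T` is `(2π)^{-n}` times the dual Fourier transform of `V`: `T(φ) = (2π)^{-n} V(φ̂)`, that is
`T(z) = (2π)^{-n} ∫ V(ξ) e^{i⟨ξ,z⟩} dξ`. -/
def IsDualFourier {n : ℕ} {O : Set (Fin n → ℝ)} (V : ExpSpace O →L[ℂ] ℂ)
    (T : TemperedUltrahyperfunction n) : Prop :=
  ∀ φ : TestSpace n, ∃ ψ : ExpSpace O, ψ.fn = fourier (fun x => φ.fn (cpt x 0)) ∧
    T φ = ((2 * Real.pi : ℝ) : ℂ)⁻¹ ^ n * V ψ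

end UHF

end

noncomputable section

namespace UHF

variable {n : ℕ}

/-! ### Elementary properties of the norms -/

/-! If ξ₀ is not in C*, some y in C has ⟨ξ₀, y⟩ < 0, and then ⟨ξ, y⟩ < -δ‖ξ‖ on an open cone around
ξ₀ (`negCone`). In both parts this gap is converted into exponential decay of the FBI transform by
choosing κ small.

Part (1). The integral of f φ over ℝⁿ + iy, moved along a complex line, is holomorphic in the
complex parameter and invariant under its real translations, hence locally constant
(`integral_cpt_eq_of_segment`). Far out in the cone any two rays can be joined (`eq_on_rays`,
`exists_joining_subcone`), so all these integrals agree and define T. On a slice in a direction y as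
above the packet has modulus exp(⟨ξ, y⟩ + κ‖ξ‖‖y‖² - κ‖ξ‖‖x - t‖²), and for small κ the negative
first term wins (`microAnalyticAt_of_slice_bound`). The argument applies to each representative f
separately.

Part (2). On the Fourier side the packet is, up to a phase and a bounded factor, the Gaussian
exp(-‖ξ - η‖²/(4κ‖ξ‖)) in η. Cut it at scale ‖ξ‖: the piece around the centre ξ lives in {⟨η, y⟩ <
0}, away from C*, so V annihilates it. On the rest ‖ξ - η‖ is at least a fixed multiple of ‖ξ‖ +
‖η‖, so for small κ the Gaussian beats both the exponential weight in η that V tolerates and the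
polynomial factors produced by differentiation (`exists_cutPacket_decay`). -/

lemma l1_smul {t : ℝ} (ht : 0 ≤ t) (y : Fin n → ℝ) : l1 (t • y) = t * l1 y := by
  simp [l1, Finset.mul_sum, abs_of_nonneg ht]

lemma continuous_l1 : Continuous (l1 : (Fin n → ℝ) → ℝ) := by
  unfold l1; fun_prop

lemma norm_le_l1 {ι 𝕜 : Type*} [Fintype ι] [NormedField 𝕜] (x : ι → 𝕜) : ‖x‖ ≤ l1 x :=
  (pi_norm_le_iff_of_nonneg (l1_nonneg x)).2 fun i =>
    Finset.single_le_sum (f := fun i => ‖x i‖) (fun _ _ => norm_nonneg _) (Finset.mem_univ i)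

lemma l1_pos {y : Fin n → ℝ} (hy : y ≠ 0) : 0 < l1 y :=
  (norm_pos_iff.2 hy).trans_le (norm_le_l1 y)

lemma ne_zero_of_l1_pos {y : Fin n → ℝ} (hy : 0 < l1 y) : y ≠ 0 := by
  rintro rfl
  simp [l1] at hy

lemma euclid_nonneg (y : Fin n → ℝ) : 0 ≤ euclid y := Real.sqrt_nonneg _

lemma euclid_sq (y : Fin n → ℝ) : euclid y ^ 2 = ∑ i, y i ^ 2 :=
  Real.sq_sqrt (Finset.sum_nonneg fun _ _ => sq_nonneg _)

lemma continuous_euclid : Continuous (euclid : (Fin n → ℝ) → ℝ) := by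
  unfold euclid; fun_prop

lemma abs_le_euclid (y : Fin n → ℝ) (i : Fin n) : |y i| ≤ euclid y := by
  refine Real.abs_le_sqrt ?_
  exact Finset.single_le_sum (f := fun i => y i ^ 2) (fun _ _ => sq_nonneg _) (Finset.mem_univ i)

lemma norm_le_euclid (y : Fin n → ℝ) : ‖y‖ ≤ euclid y :=
  (pi_norm_le_iff_of_nonneg (euclid_nonneg y)).2 fun i => abs_le_euclid y i

lemma euclid_smul {t : ℝ} (ht : 0 ≤ t) (y : Fin n → ℝ) : euclid (t • y) = t * euclid y := by
  unfold euclid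
  simp only [Pi.smul_apply, smul_eq_mul, mul_pow, ← Finset.mul_sum]
  rw [Real.sqrt_mul (sq_nonneg t), Real.sqrt_sq ht]

lemma euclid_pos {y : Fin n → ℝ} (hy : y ≠ 0) : 0 < euclid y :=
  (norm_pos_iff.2 hy).trans_le (norm_le_euclid y)

lemma isCompact_unitSphere : IsCompact (unitSphere n) := by
  refine Metric.isCompact_of_isClosed_isBounded
    (isClosed_eq continuous_euclid continuous_const) ?_
  refine isBounded_iff_forall_norm_le.2 ⟨1, fun y hy => (norm_le_euclid y).trans_eq hy⟩

lemma abs_pair_le (ξ y : Fin n → ℝ) : |pair ξ y| ≤ ‖ξ‖ * l1 y := by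
  unfold pair l1
  rw [Finset.mul_sum]
  refine (Finset.abs_sum_le_sum_abs _ _).trans (Finset.sum_le_sum fun i _ => ?_)
  rw [abs_mul]
  exact mul_le_mul_of_nonneg_right (norm_le_pi_norm ξ i) (abs_nonneg _)

lemma pair_smul_left (t : ℝ) (ξ y : Fin n → ℝ) : pair (t • ξ) y = t * pair ξ y := by
  simp [pair, Finset.mul_sum, mul_assoc]

lemma pair_smul_right (t : ℝ) (ξ y : Fin n → ℝ) : pair ξ (t • y) = t * pair ξ y := by
  simp [pair, Finset.mul_sum, mul_left_comm]

lemma pair_sub_left (ξ η y : Fin n → ℝ) : pair (ξ - η) y = pair ξ y - pair η y := by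
  simp [pair, sub_mul, Finset.sum_sub_distrib]

lemma continuous_pair_left (y : Fin n → ℝ) : Continuous fun ξ => pair ξ y := by
  unfold pair; fun_prop

/-- On one slice the exponential weight of `HoloSpace` is a constant, so this crude bound suffices.
It also covers the empty supremum, which is 0 and occurs when the dual cone is {0}. -/
lemma coneIndicator_le (Γ : Set (Fin n → ℝ)) (y : Fin n → ℝ) : coneIndicator Γ y ≤ l1 y := by
  refine Real.sSup_le ?_ (l1_nonneg y)
  rintro _ ⟨ξ, hξ, rfl⟩
  refine (abs_pair_le ξ y).trans ?_
  have := (norm_le_euclid ξ).trans_eq hξ.2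
  nlinarith [l1_nonneg y]

@[simp] lemma imPart_cpt (x y : Fin n → ℝ) : imPart (cpt x y) = y := by
  funext j; simp [imPart, cpt]

lemma norm_le_norm_cpt (x y : Fin n → ℝ) : ‖x‖ ≤ ‖cpt x y‖ := by
  refine (pi_norm_le_iff_of_nonneg (norm_nonneg _)).2 fun i => ?_
  refine le_trans ?_ (norm_le_pi_norm (cpt x y) i)
  simpa [cpt] using Complex.abs_re_le_norm (cpt x y i)

lemma norm_le_l1_cpt (x y : Fin n → ℝ) : ‖x‖ ≤ l1 (cpt x y) :=
  (norm_le_norm_cpt x y).trans (norm_le_l1 _)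

lemma l1_cpt_le (x y : Fin n → ℝ) : l1 (cpt x y) ≤ n * ‖x‖ + l1 y := by
  have h : ∀ i, ‖cpt x y i‖ ≤ ‖x‖ + ‖y i‖ := fun i => by
    refine (norm_add_le _ _).trans ?_
    simpa using norm_le_pi_norm x i
  refine (Finset.sum_le_sum fun i _ => h i).trans_eq ?_
  simp [Finset.sum_add_distrib, l1]

lemma continuous_cpt (y : Fin n → ℝ) : Continuous fun x : Fin n → ℝ => cpt x y := by
  unfold cpt; fun_prop

/-! ### Compact subcones -/

/-- The cone of all points whose projection to the unit sphere of the supremum norm is at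
distance at most `δ` from `K`. -/
def coneAround (K : Set (Fin n → ℝ)) (δ : ℝ) : Set (Fin n → ℝ) :=
  {v | v ≠ 0 ∧ ‖v‖⁻¹ • v ∈ Metric.cthickening δ K}

lemma continuousAt_normalize {v : Fin n → ℝ} (hv : v ≠ 0) :
    ContinuousAt (fun w : Fin n → ℝ => ‖w‖⁻¹ • w) v :=
  (continuousAt_id.norm.inv₀ (norm_ne_zero_iff.2 hv)).smul continuousAt_id

lemma normalize_smul {t : ℝ} (ht : 0 < t) (v : Fin n → ℝ) :
    ‖t • v‖⁻¹ • t • v = ‖v‖⁻¹ • v := by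
  rw [norm_smul, Real.norm_of_nonneg ht.le, mul_inv, smul_smul]
  congr 1
  field_simp

/-- Every compact subset of an open cone which does not contain the origin generates a cone
inside the interior of a compact subcone. -/
lemma exists_compactSubcone {C K : Set (Fin n → ℝ)} (hopen : IsOpen C) (hcone : IsCone C)
    (hK : IsCompact K) (hKC : K ⊆ C) (h0 : (0 : Fin n → ℝ) ∉ K) :
    ∃ C', IsCompactSubcone C' C ∧ ∀ k ∈ K, ∀ t : ℝ, 0 < t → t • k ∈ interior C' := by
  set K' : Set (Fin n → ℝ) := (fun w : Fin n → ℝ => ‖w‖⁻¹ • w) '' K with hK'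
  have hne : ∀ k ∈ K, k ≠ 0 := fun k hk h => h0 (h ▸ hk)
  have hK'c : IsCompact K' := hK.image_of_continuousOn fun k hk =>
    (continuousAt_normalize (hne k hk)).continuousWithinAt
  have hK'C : K' ⊆ C := by
    rintro _ ⟨k, hk, rfl⟩
    exact hcone k (hKC hk) _ (inv_pos.2 (norm_pos_iff.2 (hne k hk)))
  -- The thickening is closed, which keeps the closure of the generated cone inside C; its positive
  -- width puts the rays through K in the interior.
  obtain ⟨δ, hδ, hδC⟩ := hK'c.exists_cthickening_subset_open hopen hK'C
  refine ⟨coneAround K' δ, ⟨?_, ?_⟩, ?_⟩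
  · rintro v ⟨hv, hvK⟩ t ht
    refine ⟨smul_ne_zero ht.ne' hv, ?_⟩
    rwa [normalize_smul ht]
  · rintro v ⟨hv, hvS⟩
    refine ⟨?_, hvS⟩
    have hv0 : v ≠ 0 := by
      rintro rfl
      simp [unitSphere, euclid] at hvS
    have hmem : ‖v‖⁻¹ • v ∈ Metric.cthickening δ K' := by
      rw [← Metric.isClosed_cthickening.closure_eq]
      exact (continuousAt_normalize hv0).continuousWithinAt.mem_closure hv fun w hw => hw.2
    have := hcone _ (hδC hmem) ‖v‖ (norm_pos_iff.2 hv0)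
    rwa [smul_smul, mul_inv_cancel₀ (norm_ne_zero_iff.2 hv0), one_smul] at this
  · intro k hk t ht
    have htk : t • k ≠ 0 := smul_ne_zero ht.ne' (hne k hk)
    rw [mem_interior_iff_mem_nhds]
    have h1 : Metric.thickening δ K' ∈ 𝓝 (‖t • k‖⁻¹ • t • k) := by
      refine Metric.isOpen_thickening.mem_nhds (Metric.self_subset_thickening hδ _ ?_)
      rw [normalize_smul ht]
      exact ⟨k, hk, rfl⟩
    filter_upwards [continuousAt_normalize htk h1, isOpen_ne.mem_nhds htk] with w hw hw0
    exact ⟨hw0, Metric.thickening_subset_cthickening _ _ hw⟩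

/-- A function which is constant on segments in `{y ∈ interior C' | r < |y|}` takes the same
value at points of two rays if the segment between generators of these rays spans a cone in
the interior of `C'`. -/
lemma eq_on_rays {C' : Set (Fin n → ℝ)} {r : ℝ} {F : (Fin n → ℝ) → ℂ}
    (hF : ∀ a b, segment ℝ a b ⊆ {y | y ∈ interior C' ∧ r < l1 y} → F a = F b)
    {k₁ k₂ : Fin n → ℝ}
    (hk : ∀ p ∈ segment ℝ k₁ k₂, p ≠ 0 ∧ ∀ t : ℝ, 0 < t → t • p ∈ interior C')
    {a b : ℝ} (ha : 0 < a) (hb : 0 < b) (hra : r < l1 (a • k₁)) (hrb : r < l1 (b • k₂)) :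
    F (a • k₁) = F (b • k₂) := by
  have hcomp : IsCompact (segment ℝ k₁ k₂) := by
    rw [segment_eq_image_lineMap]
    exact isCompact_Icc.image (by fun_prop)
  -- The segment avoids the origin, so its least ℓ¹-norm is positive and one dilation `lam` carries
  -- all of it beyond radius r. The path runs out along the first ray to `lam`, across the dilated
  -- segment, and back along the second ray.
  obtain ⟨p, hp, hmin⟩ := hcomp.exists_isMinOn ⟨k₁, left_mem_segment ℝ k₁ k₂⟩
    continuous_l1.continuousOn
  have hpos : 0 < l1 p := l1_pos (hk p hp).1
  obtain ⟨N, hN⟩ := exists_gt (r / l1 p)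
  set lam : ℝ := max N (max a b) with hlam
  have hal : a ≤ lam := (le_max_left _ _).trans (le_max_right _ _)
  have hbl : b ≤ lam := (le_max_right _ _).trans (le_max_right _ _)
  have hl0 : 0 < lam := ha.trans_le hal
  have hlr : r < lam * l1 p := by
    rw [div_lt_iff₀ hpos] at hN
    exact hN.trans_le (mul_le_mul_of_nonneg_right (le_max_left _ _) hpos.le)
  have ray : ∀ k ∈ segment ℝ k₁ k₂, ∀ c : ℝ, 0 < c → c ≤ lam → r < l1 (c • k) →
      F (c • k) = F (lam • k) := by
    intro k hkm c hc hcl hrc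
    refine hF _ _ ?_
    rintro _ ⟨s, t, hs, ht, hst, rfl⟩
    rw [smul_smul, smul_smul, ← add_smul]
    have h1 : c ≤ s * c + t * lam := by
      have : c = s * c + t * c := by rw [← add_mul, hst, one_mul]
      nlinarith
    refine ⟨(hk k hkm).2 _ (hc.trans_le h1), hrc.trans_le ?_⟩
    rw [l1_smul hc.le, l1_smul (hc.trans_le h1).le]
    exact mul_le_mul_of_nonneg_right h1 (l1_nonneg k)
  rw [ray k₁ (left_mem_segment ℝ _ _) a ha hal hra, ray k₂ (right_mem_segment ℝ _ _) b hb hbl hrb]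
  refine hF _ _ ?_
  rintro _ ⟨s, t, hs, ht, hst, rfl⟩
  have hq : s • k₁ + t • k₂ ∈ segment ℝ k₁ k₂ := ⟨s, t, hs, ht, hst, rfl⟩
  rw [show s • lam • k₁ + t • lam • k₂ = lam • (s • k₁ + t • k₂) by
    rw [smul_add, smul_comm s, smul_comm t]]
  refine ⟨(hk _ hq).2 lam hl0, hlr.trans_le ?_⟩
  rw [l1_smul hl0.le]
  exact mul_le_mul_of_nonneg_left (hmin hq) hl0.le

/-! ### Shifting the contour of integration -/

/-- The integrable weight `(1 + ‖x‖)^{-(n+1)}`. -/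
def decay (x : Fin n → ℝ) : ℝ := (1 + ‖x‖) ^ (-((n : ℝ) + 1))

lemma decay_pos (x : Fin n → ℝ) : 0 < decay x :=
  Real.rpow_pos_of_pos (by positivity) _

lemma integrable_decay : Integrable (decay : (Fin n → ℝ) → ℝ) :=
  integrable_one_add_norm (by simp)

lemma decay_eq (x : Fin n → ℝ) : decay x = ((1 + ‖x‖) ^ (n + 1))⁻¹ := by
  have : (0 : ℝ) ≤ 1 + ‖x‖ := by positivity
  rw [decay, Real.rpow_neg this, ← Real.rpow_natCast]
  norm_cast

/-- Follows from 1 + ‖x‖ ≤ (1 + R)(1 + ‖x + u‖). It lets one integrable majorant serve all bounded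
translates of a slice. -/
lemma decay_add_le {R : ℝ} (x u : Fin n → ℝ) (hu : ‖u‖ ≤ R) :
    decay (x + u) ≤ (1 + R) ^ (n + 1) * decay x := by
  have h0 : 0 ≤ R := (norm_nonneg u).trans hu
  rw [decay_eq, decay_eq, ← div_eq_mul_inv, inv_eq_one_div,
    div_le_div_iff₀ (by positivity) (by positivity), one_mul, ← mul_pow]
  refine pow_le_pow_left₀ (by positivity) ?_ _
  have h1 : ‖x‖ ≤ ‖x + u‖ + ‖u‖ := by
    simpa using norm_sub_le (x + u) u
  nlinarith [norm_nonneg (x + u)]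

lemma l1_add_le (x y : Fin n → ℝ) : l1 (x + y) ≤ l1 x + l1 y := by
  simp only [l1, ← Finset.sum_add_distrib]
  exact Finset.sum_le_sum fun i _ => norm_add_le _ _

lemma l1_smul_abs (t : ℝ) (y : Fin n → ℝ) : l1 (t • y) = |t| * l1 y := by
  simp [l1, Finset.mul_sum]

/-- The point `x + i a + w v` of the complex line through `x + i a` in the direction `v`. -/
def linePt (a v x : Fin n → ℝ) (w : ℂ) : Fin n → ℂ := fun j => cpt x a j + w * (v j : ℂ)

lemma linePt_eq (a v x : Fin n → ℝ) (w : ℂ) :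
    linePt a v x w = cpt (x + w.re • v) (a + w.im • v) := by
  funext j
  apply Complex.ext <;> simp [linePt, cpt]

lemma hasDerivAt_linePt (a v x : Fin n → ℝ) (w : ℂ) :
    HasDerivAt (linePt a v x) (fun j => (v j : ℂ)) w := by
  refine hasDerivAt_pi.2 fun j => ?_
  simpa [linePt] using ((hasDerivAt_id w).mul_const (v j : ℂ)).const_add (cpt x a j)

/-- The integral of a holomorphic function over `ℝⁿ + i y` does not change along a segment. -/
lemma integral_cpt_eq_of_segment {D : Set (Fin n → ℝ)} (hD : IsOpen D) {g : (Fin n → ℂ) → ℂ}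
    (hg : ∀ x, ∀ y ∈ D, DifferentiableAt ℂ g (cpt x y))
    (hb : ∀ Y : ℝ, ∃ M : ℝ, ∀ y ∈ D, l1 y ≤ Y → ∀ x, ‖g (cpt x y)‖ ≤ M * decay x)
    {a b : Fin n → ℝ} (hab : segment ℝ a b ⊆ D) :
    ∫ x, g (cpt x a) = ∫ x, g (cpt x b) := by
  set v := b - a with hv
  set vC : Fin n → ℂ := fun j => (v j : ℂ) with hvC
  -- The segment is w = is with 0 ≤ s ≤ 1. A real increment of w translates x and leaves `H`
  -- unchanged, so the complex derivative of `H` vanishes at every such point.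
  set H : ℂ → ℂ := fun w => ∫ x, g (linePt a v x w) with hH
  set O : Set ℂ := {w | a + w.im • v ∈ D} with hO
  have hOo : IsOpen O := hD.preimage (by fun_prop)
  have hderiv : ∀ x, ∀ w ∈ O,
      HasDerivAt (fun w => g (linePt a v x w)) (fderiv ℂ g (linePt a v x w) vC) w := by
    intro x w hw
    have h1 : DifferentiableAt ℂ g (linePt a v x w) := by
      rw [linePt_eq]; exact hg _ _ hw
    exact h1.hasFDerivAt.comp_hasDerivAt w (hasDerivAt_linePt a v x w)
  have hcont : ∀ w, Continuous fun x => linePt a v x w := by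
    intro w; unfold linePt cpt; fun_prop
  have hgcont : ∀ w ∈ O, Continuous fun x => g (linePt a v x w) := by
    intro w hw
    refine continuous_iff_continuousAt.2 fun x => ?_
    have h1 : ContinuousAt g (linePt a v x w) := by
      rw [linePt_eq]; exact (hg _ _ hw).continuousAt
    exact ContinuousAt.comp (f := fun x => linePt a v x w) h1 (hcont w).continuousAt
  have hHderiv : ∀ s : ℝ, (s : ℂ) * Complex.I ∈ O → HasDerivAt H 0 (s * Complex.I) := by
    intro s hs
    obtain ⟨ρ', hρ', hball'⟩ := Metric.isOpen_iff.1 hOo _ hs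
    -- Discs of radius ρ around points of the ρ-disc must stay in `O`, and 2ρ < ρ' ensures it. The
    -- cap 1 bounds |Re w| by 2.
    set ρ := min (ρ' / 3) 1 with hρ
    have hρ0 : 0 < ρ := lt_min (by positivity) one_pos
    have hρ1 : ρ ≤ 1 := min_le_right _ _
    have hball : ∀ w, dist w (s * Complex.I) ≤ 2 * ρ → w ∈ O := fun w hw => hball' (by
      have : ρ ≤ ρ' / 3 := min_le_left _ _
      rw [Metric.mem_ball]; linarith)
    obtain ⟨M, hM⟩ := hb (l1 a + (|s| + 2) * l1 v)
    set B := |M| * (1 + 2 * ‖v‖) ^ (n + 1) with hB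
    have hbound : ∀ x w, dist w (s * Complex.I) ≤ 2 * ρ →
        ‖g (linePt a v x w)‖ ≤ B * decay x := by
      intro x w hw
      have hwn : ‖w - s * Complex.I‖ ≤ 2 * ρ := by rwa [← dist_eq_norm]
      have hre : |w.re| ≤ 2 := by
        have := (Complex.abs_re_le_norm (w - s * Complex.I)).trans hwn
        simp at this; linarith
      have him : |w.im| ≤ |s| + 2 := by
        have h1 := (Complex.abs_im_le_norm (w - s * Complex.I)).trans hwn
        simp at h1
        have h2 := abs_sub_abs_le_abs_sub w.im s
        linarith
      have hY : l1 (a + w.im • v) ≤ l1 a + (|s| + 2) * l1 v := by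
        refine (l1_add_le _ _).trans ?_
        rw [l1_smul_abs]
        gcongr
        exact l1_nonneg v
      rw [linePt_eq]
      refine (hM _ (hball w hw) hY _).trans ?_
      have h3 : decay (x + w.re • v) ≤ (1 + 2 * ‖v‖) ^ (n + 1) * decay x := by
        refine decay_add_le x _ ?_
        rw [norm_smul]
        exact mul_le_mul_of_nonneg_right hre (norm_nonneg v)
      calc M * decay (x + w.re • v) ≤ |M| * decay (x + w.re • v) :=
            mul_le_mul_of_nonneg_right (le_abs_self M) (decay_pos _).le
        _ ≤ |M| * ((1 + 2 * ‖v‖) ^ (n + 1) * decay x) :=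
            mul_le_mul_of_nonneg_left h3 (abs_nonneg M)
        _ = B * decay x := by rw [hB]; ring
    have hint : ∀ w, dist w (s * Complex.I) ≤ 2 * ρ →
        Integrable fun x => g (linePt a v x w) := fun w hw =>
      (integrable_decay.const_mul B).mono' (hgcont w (hball w hw)).aestronglyMeasurable
        (Eventually.of_forall fun x => hbound x w hw)
    have main := (hasDerivAt_integral_of_dominated_loc_of_deriv_le
      (μ := volume) (F := fun w x => g (linePt a v x w))
      (F' := fun w x => fderiv ℂ g (linePt a v x w) vC)
      (bound := fun x => B / ρ * decay x) (x₀ := (s : ℂ) * Complex.I)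
      (Metric.ball_mem_nhds _ hρ0)
      (by
        filter_upwards [hOo.mem_nhds hs] with w hw using (hgcont w hw).aestronglyMeasurable)
      (hint _ (by rw [dist_self]; positivity))
      (((measurable_fderiv_apply_const ℂ g vC).comp
        (hcont _).measurable).aestronglyMeasurable)
      (Eventually.of_forall fun x w hw => by
        rw [Metric.mem_ball] at hw
        -- Cauchy's estimate on the circle of radius ρ about w turns the bound B · decay for the
        -- integrand into B/ρ · decay for its derivative.
        have hcl : ∀ w' ∈ Metric.closedBall w ρ, dist w' (s * Complex.I) ≤ 2 * ρ := by
          intro w' hw'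
          rw [Metric.mem_closedBall] at hw'
          linarith [dist_triangle w' w (s * Complex.I)]
        have hw2 : dist w (s * Complex.I) ≤ 2 * ρ := by linarith
        rw [← (hderiv x w (hball w hw2)).deriv]
        refine (Complex.norm_deriv_le_of_forall_mem_sphere_norm_le hρ0 ?_
          (fun w' hw' => hbound x w' (hcl w' (Metric.sphere_subset_closedBall hw')))).trans_eq
          (by ring)
        refine DifferentiableOn.diffContOnCl fun w' hw' => ?_
        rw [closure_ball w hρ0.ne'] at hw'
        exact (hderiv x w' (hball w' (hcl w' hw'))).differentiableAt.differentiableWithinAt)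
      (integrable_decay.const_mul _)
      (Eventually.of_forall fun x w hw => hderiv x w (hball w (by
        rw [Metric.mem_ball] at hw; linarith)))).2
    have htrans : ∀ u : ℝ, H (s * Complex.I + u) = H (s * Complex.I) := by
      intro u
      have h1 : ∀ x, linePt a v x (s * Complex.I + u) = linePt a v (x + u • v) (s * Complex.I) := by
        intro x
        rw [linePt_eq, linePt_eq]
        simp
      simp only [hH, h1]
      exact integral_add_right_eq_self (fun x => g (linePt a v x (s * Complex.I))) (u • v)
    have hzero : HasDerivAt (fun u : ℝ => H (s * Complex.I + u)) 0 0 := by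
      simp only [htrans]; exact hasDerivAt_const _ _
    have hline : HasDerivAt (fun u : ℝ => (s : ℂ) * Complex.I + u) 1 0 := by
      simpa using (Complex.ofRealCLM.hasDerivAt (x := (0 : ℝ))).const_add ((s : ℂ) * Complex.I)
    have hcomp := HasDerivAt.comp_of_eq (h₂ := H) (0 : ℝ) main hline (by simp)
    have := hzero.unique hcomp
    rw [mul_one] at this
    rw [this]; exact main
  have hseg : ∀ s ∈ Icc (0 : ℝ) 1, (s : ℂ) * Complex.I ∈ O := by
    intro s hs
    refine hab ?_
    rw [segment_eq_image']
    exact ⟨s, hs, by simp [hv]⟩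
  have hd : ∀ s ∈ Icc (0 : ℝ) 1, HasDerivAt (fun s : ℝ => H (s * Complex.I)) 0 s := by
    intro s hs
    have h1 : HasDerivAt (fun u : ℝ => (u : ℂ) * Complex.I) Complex.I s := by
      simpa using (Complex.ofRealCLM.hasDerivAt (x := s)).mul_const Complex.I
    have h2 := (hHderiv s (hseg s hs)).comp s h1
    rw [zero_mul] at h2
    exact h2
  have h01 := constant_of_has_deriv_right_zero (f := fun s : ℝ => H (s * Complex.I))
    (a := 0) (b := 1) (fun s hs => (hd s hs).continuousAt.continuousWithinAt)
    (fun s hs => (hd s (Ico_subset_Icc_self hs)).hasDerivWithinAt) 1 (by simp)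
  have e0 : ∀ x, linePt a v x ((0 : ℝ) * Complex.I) = cpt x a := fun x => by
    rw [linePt_eq]; simp
  have e1 : ∀ x, linePt a v x ((1 : ℝ) * Complex.I) = cpt x b := fun x => by
    rw [linePt_eq]; simp [hv]
  simp only [hH, e0, e1] at h01
  exact h01.symm

/-! ### Joining the points of a cone to a fixed ray -/

lemma IsCone.eq_univ_of_zero_mem {C : Set (Fin n → ℝ)} (hopen : IsOpen C) (hcone : IsCone C)
    (h0 : (0 : Fin n → ℝ) ∈ C) : C = univ := by
  refine eq_univ_of_forall fun y => ?_
  -- Small positive multiples of y enter the neighbourhood C of 0; scaling back gives y.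
  have hc : Tendsto (fun t : ℝ => t • y) (𝓝[>] 0) (𝓝 0) := by
    have : Continuous fun t : ℝ => t • y := by fun_prop
    simpa using (this.tendsto 0).mono_left nhdsWithin_le_nhds
  obtain ⟨t, ht, ht0⟩ := ((hc.eventually (hopen.mem_nhds h0)).and self_mem_nhdsWithin).exists
  have := hcone _ ht t⁻¹ (inv_pos.2 ht0)
  rwa [smul_smul, inv_mul_cancel₀ (ne_of_gt ht0), one_smul] at this

lemma exists_ne_zero_mem {C : Set (Fin n → ℝ)} (hn : 1 ≤ n) (hopen : IsOpen C)
    (hcone : IsCone C) (hne : C.Nonempty) : ∃ y ∈ C, y ≠ 0 := by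
  obtain ⟨y, hy⟩ := hne
  by_cases h : y = 0
  · subst h
    rw [IsCone.eq_univ_of_zero_mem hopen hcone hy]
    refine ⟨fun _ => 1, mem_univ _, fun h => ?_⟩
    simpa using congrFun h ⟨0, hn⟩
  · exact ⟨y, hy, h⟩

/-- In dimension at least two, two nonzero points can be joined by at most two segments which
avoid the origin. -/
lemma exists_segments_avoid_zero (hn : 2 ≤ n) {y y' : Fin n → ℝ} (hy : y ≠ 0) (hy' : y' ≠ 0) :
    (0 : Fin n → ℝ) ∉ segment ℝ y y' ∨
      ∃ w, (0 : Fin n → ℝ) ∉ segment ℝ y w ∧ (0 : Fin n → ℝ) ∉ segment ℝ w y' := by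
  by_cases h : (0 : Fin n → ℝ) ∈ segment ℝ y y'
  · right
    obtain ⟨s, t, hs, ht, hst, h0⟩ := h
    -- Here y and y' are opposite, so they share a nonzero coordinate i. A unit vector along another
    -- coordinate j is proportional to neither and serves as a detour.
    obtain ⟨i, hi⟩ := Function.ne_iff.1 hy
    have hi : y i ≠ 0 := hi
    have hi' : y' i ≠ 0 := by
      intro hz
      have := congrFun h0 i
      simp only [Pi.add_apply, Pi.smul_apply, smul_eq_mul, hz, mul_zero, add_zero,
        Pi.zero_apply, mul_eq_zero, hi, or_false] at this
      rw [this, zero_smul, zero_add] at h0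
      rw [this, zero_add] at hst
      rw [hst, one_smul] at h0
      exact hy' h0
    have : Nontrivial (Fin n) := Fin.nontrivial_iff_two_le.2 hn
    obtain ⟨j, hj⟩ := exists_ne i
    have key : ∀ z : Fin n → ℝ, z i ≠ 0 →
        (0 : Fin n → ℝ) ∉ segment ℝ z (Pi.single j 1) := by
      rintro z hz ⟨a, b, -, -, hab, h⟩
      have h1 := congrFun h i
      have h2 := congrFun h j
      simp only [Pi.add_apply, Pi.smul_apply, smul_eq_mul, Pi.single_eq_of_ne hj.symm, mul_zero,
        add_zero, Pi.zero_apply, mul_eq_zero, hz, or_false] at h1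
      subst h1
      simp at h2 hab
      linarith
    exact ⟨Pi.single j 1, key y hi, segment_symm ℝ y' (Pi.single j 1) ▸ key y' hi'⟩
  · exact Or.inl h

/-- Every compact subcone is contained in a larger one, in which all its points can be joined
to a fixed ray. -/
lemma exists_joining_subcone {C : Set (Fin n → ℝ)} (hn : 1 ≤ n) (hopen : IsOpen C)
    (hconv : Convex ℝ C) (hcone : IsCone C) (hline : n = 1 → C ≠ univ)
    {C' : Set (Fin n → ℝ)} (hC' : IsCompactSubcone C' C) {y₀ : Fin n → ℝ} (hy₀ : y₀ ∈ C)
    (hy₀' : y₀ ≠ 0) :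
    ∃ C'', IsCompactSubcone C'' C ∧ (∀ y ∈ C', y ≠ 0 → y ∈ C'') ∧
      ∀ (r : ℝ) (F : (Fin n → ℝ) → ℂ), 0 < r →
        (∀ a b, segment ℝ a b ⊆ {y | y ∈ interior C'' ∧ r < l1 y} → F a = F b) →
        ∀ y ∈ C', r < l1 y → ∀ b : ℝ, 0 < b → r < l1 (b • y₀) → F y = F (b • y₀) := by
  -- If 0 ∈ C then C is the whole space, and a segment to y₀ may cross the origin; the detour around
  -- it requires n ≥ 2, which `hline` provides.
  by_cases h0 : (0 : Fin n → ℝ) ∈ C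
  · have huniv := IsCone.eq_univ_of_zero_mem hopen hcone h0
    subst huniv
    have hn2 : 2 ≤ n := by
      by_contra h
      exact hline (by omega) rfl
    refine ⟨univ, ⟨fun _ _ _ _ => mem_univ _, by simp⟩, fun _ _ _ => mem_univ _, ?_⟩
    intro r F hr hF y hy hry b hb hrb
    have hy0 : y ≠ 0 := ne_zero_of_l1_pos (hr.trans hry)
    have key : ∀ k₁ k₂ : Fin n → ℝ, (0 : Fin n → ℝ) ∉ segment ℝ k₁ k₂ → ∀ a b : ℝ, 0 < a →
        0 < b → r < l1 (a • k₁) → r < l1 (b • k₂) → F (a • k₁) = F (b • k₂) := by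
      intro k₁ k₂ h a b ha hb hra hrb
      exact eq_on_rays hF (fun p hp => ⟨fun h' => h (h' ▸ hp), by simp⟩) ha hb hra hrb
    rw [← one_smul ℝ y] at hry ⊢
    rcases exists_segments_avoid_zero hn2 hy0 hy₀' with h | ⟨w, h1, h2⟩
    · exact key _ _ h 1 b one_pos hb hry hrb
    · have hw : 0 < l1 w := l1_pos fun hw => h1 (hw ▸ right_mem_segment ℝ y w)
      obtain ⟨c, hc⟩ := exists_gt (r / l1 w)
      have hc0 : 0 < c := lt_trans (by positivity) hc
      have hrc : r < l1 (c • w) := by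
        rw [l1_smul hc0.le]; rwa [div_lt_iff₀ hw] at hc
      rw [key _ _ h1 1 c one_pos hc0 hry hrc, key _ _ h2 c b hc0 hb hrc hrb]
  -- Otherwise convexity keeps every segment from `K₀` to y₀ in C, hence off the origin. These
  -- segments sweep out a compact set, which generates the larger subcone.
  · set K₀ := closure C' ∩ unitSphere n with hK₀
    have hK₀c : IsCompact K₀ := isCompact_unitSphere.inter_left isClosed_closure
    set K : Set (Fin n → ℝ) :=
      (fun p : (Fin n → ℝ) × ℝ => AffineMap.lineMap p.1 y₀ p.2) '' (K₀ ×ˢ Icc (0 : ℝ) 1) with hK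
    have hKc : IsCompact K := (hK₀c.prod isCompact_Icc).image (by
      simp only [AffineMap.lineMap_apply_module]; fun_prop)
    have hseg : ∀ k ∈ K₀, segment ℝ k y₀ ⊆ K := by
      intro k hk p hp
      rw [segment_eq_image_lineMap] at hp
      obtain ⟨s, hs, rfl⟩ := hp
      exact ⟨(k, s), ⟨hk, hs⟩, rfl⟩
    have hKC : K ⊆ C := by
      rintro _ ⟨⟨k, s⟩, ⟨hk, hs⟩, rfl⟩
      refine hconv.segment_subset (hC'.2 hk).1 hy₀ ?_
      rw [segment_eq_image_lineMap]
      exact ⟨s, hs, rfl⟩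
    obtain ⟨C'', hC'', hint⟩ := exists_compactSubcone hopen hcone hKc hKC fun h => h0 (hKC h)
    have hproj : ∀ y ∈ C', y ≠ 0 → ∃ k ∈ K₀, y = euclid y • k := by
      intro y hy hy0
      have hp := euclid_pos hy0
      refine ⟨(euclid y)⁻¹ • y, ⟨subset_closure (hC'.1 y hy _ (inv_pos.2 hp)), ?_⟩, ?_⟩
      · change euclid _ = 1
        rw [euclid_smul (inv_pos.2 hp).le, inv_mul_cancel₀ hp.ne']
      · rw [smul_smul, mul_inv_cancel₀ hp.ne', one_smul]
    refine ⟨C'', hC'', fun y hy hy0 => ?_, ?_⟩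
    · obtain ⟨k, hk, e⟩ := hproj y hy hy0
      rw [e]
      exact interior_subset (hint k (hseg k hk (left_mem_segment ℝ _ _)) _ (euclid_pos hy0))
    · intro r F hr hF y hy hry b hb hrb
      have hy0 : y ≠ 0 := ne_zero_of_l1_pos (hr.trans hry)
      obtain ⟨k, hk, e⟩ := hproj y hy hy0
      have := eq_on_rays (k₁ := k) (k₂ := y₀) (a := euclid y) (b := b) hF
        (fun p hp => ⟨fun h => h0 (h ▸ hKC (hseg k hk hp)), hint p (hseg k hk hp)⟩)
        (euclid_pos hy0) hb (by rwa [← e]) hrb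
      rwa [← e] at this

/-! ### The functional represented by an element of `ℋ°_c` -/

/-- The integral of `f φ` over `ℝⁿ + i y`. -/
def sliceIntegral (f : (Fin n → ℂ) → ℂ) (φ : TestSpace n) (y : Fin n → ℝ) : ℂ :=
  ∫ x : Fin n → ℝ, f (cpt x y) * φ.fn (cpt x y)

lemma le_testSeminorm (K : CompactConvexIn (univ : Set (Fin n → ℝ))) (N : ℕ) (φ : TestSpace n)
    {z : Fin n → ℂ} (hz : imPart z ∈ K.1) :
    (1 + l1 z) ^ N * ‖φ.fn z‖ ≤ testSeminorm n (K, N) φ := by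
  obtain ⟨M, hM⟩ := φ.mem.2 K N
  have hbdd : BddAbove (range fun z : {z : Fin n → ℂ // imPart z ∈ K.1} => testEval N z.1 φ) := by
    refine ⟨M, ?_⟩
    rintro _ ⟨z, rfl⟩
    exact hM z.1 z.2
  exact le_ciSup hbdd ⟨z, hz⟩

/-- Of the N + (n + 1) powers of 1 + |z| in the hypothesis, N absorb the growth of f and the
remaining n + 1 pay for the integrable weight, because ‖x‖ ≤ |x + iy|. -/
lemma norm_mul_le_decay {C' : Set (Fin n → ℝ)} {Γ : Set (Fin n → ℝ)} {r M : ℝ} {N : ℕ}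
    {f : (Fin n → ℂ) → ℂ}
    (hb : ∀ z ∈ tube C' r,
      ‖f z‖ ≤ M * (1 + l1 z) ^ N * Real.exp (coneIndicator Γ (imPart z)))
    {x y : Fin n → ℝ} (hy : y ∈ C') (hr : r < l1 y) {c : ℂ} {S : ℝ}
    (hS : (1 + l1 (cpt x y)) ^ (N + (n + 1)) * ‖c‖ ≤ S) :
    ‖f (cpt x y) * c‖ ≤ |M| * Real.exp (l1 y) * S * decay x := by
  have h1 := hb (cpt x y) ⟨by simpa using hy, by simpa using hr⟩
  rw [imPart_cpt] at h1
  have hl := l1_nonneg (cpt x y)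
  have h2 : ‖f (cpt x y)‖ ≤ |M| * (1 + l1 (cpt x y)) ^ N * Real.exp (l1 y) :=
    h1.trans (mul_le_mul
      (mul_le_mul_of_nonneg_right (le_abs_self M) (by positivity))
      (Real.exp_le_exp.2 (coneIndicator_le _ _)) (Real.exp_pos _).le (by positivity))
  have h3 : 1 ≤ (1 + l1 (cpt x y)) ^ (n + 1) * decay x := by
    rw [decay_eq, ← div_eq_mul_inv, one_le_div (by positivity)]
    exact pow_le_pow_left₀ (by positivity) (by linarith [norm_le_l1_cpt x y]) _
  rw [norm_mul]
  calc ‖f (cpt x y)‖ * ‖c‖ ≤ (|M| * (1 + l1 (cpt x y)) ^ N * Real.exp (l1 y) * ‖c‖) * 1 := by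
        rw [mul_one]; exact mul_le_mul_of_nonneg_right h2 (norm_nonneg c)
    _ ≤ (|M| * (1 + l1 (cpt x y)) ^ N * Real.exp (l1 y) * ‖c‖) *
        ((1 + l1 (cpt x y)) ^ (n + 1) * decay x) := by
        exact mul_le_mul_of_nonneg_left h3 (by positivity)
    _ = |M| * Real.exp (l1 y) * ((1 + l1 (cpt x y)) ^ (N + (n + 1)) * ‖c‖) * decay x := by
        rw [pow_add]; ring
    _ ≤ _ := by
        exact mul_le_mul_of_nonneg_right (mul_le_mul_of_nonneg_left hS (by positivity))
          (decay_pos x).le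

/-- For `|y|` large the slice integrals of an element of `ℋ°_c` converge, are continuous
in the test function, and do not change along segments. -/
lemma exists_slice_radius {C : Set (Fin n → ℝ)} (f : HoloSpace C) {C' : Set (Fin n → ℝ)}
    (hC' : IsCompactSubcone C' C) : ∃ r : ℝ, 0 < r ∧
      (∀ φ a b, segment ℝ a b ⊆ {y | y ∈ interior C' ∧ r < l1 y} →
        sliceIntegral f.1 φ a = sliceIntegral f.1 φ b) ∧
      ∀ y ∈ C', r < l1 y →
        (∀ φ : TestSpace n, Integrable fun x => f.1 (cpt x y) * φ.fn (cpt x y)) ∧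
        ∃ (A : ℝ) (N : ℕ), 0 ≤ A ∧ ∀ (φ : TestSpace n) (S : ℝ),
          (∀ x, (1 + l1 (cpt x y)) ^ N * ‖φ.fn (cpt x y)‖ ≤ S) →
            ‖sliceIntegral f.1 φ y‖ ≤ A * S := by
  obtain ⟨r, hr, hd, M, N, hb⟩ := f.2 C' hC'
  have hmem : ∀ x : Fin n → ℝ, ∀ y ∈ C', r < l1 y → cpt x y ∈ tube C' r := fun x y hy hry =>
    ⟨by simpa using hy, by simpa using hry⟩
  refine ⟨r, hr, fun φ a b hab => ?_, fun y hy hry => ⟨fun φ => ?_, ?_⟩⟩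
  · refine integral_cpt_eq_of_segment (g := fun z => f.1 z * φ.fn z)
      (isOpen_interior.inter (isOpen_lt continuous_const continuous_l1)) ?_ ?_ hab
    · rintro x y ⟨hy, hry⟩
      exact (hd _ (hmem x y (interior_subset hy) hry)).mul φ.mem.1.differentiableAt
    · intro Y
      -- All y with |y| ≤ Y lie in one ball, so a single seminorm of φ gives a bound uniform in y.
      set K : CompactConvexIn (univ : Set (Fin n → ℝ)) :=
        ⟨Metric.closedBall 0 Y, isCompact_closedBall _ _, convex_closedBall _ _, subset_univ _⟩
      set S := testSeminorm n (K, N + (n + 1)) φ with hS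
      have hS0 : 0 ≤ S := apply_nonneg _ _
      refine ⟨|M| * Real.exp Y * S, ?_⟩
      rintro y ⟨hy, hry⟩ hY x
      refine (norm_mul_le_decay hb (interior_subset hy) hry
        (le_testSeminorm K (N + (n + 1)) φ ?_)).trans ?_
      · rw [imPart_cpt]
        exact mem_closedBall_zero_iff.2 ((norm_le_l1 y).trans hY)
      · refine mul_le_mul_of_nonneg_right (mul_le_mul_of_nonneg_right
          (mul_le_mul_of_nonneg_left (Real.exp_le_exp.2 hY) (abs_nonneg M)) hS0) (decay_pos x).le
  · set K : CompactConvexIn (univ : Set (Fin n → ℝ)) :=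
      ⟨{y}, isCompact_singleton, convex_singleton y, subset_univ _⟩
    refine (integrable_decay.const_mul _).mono' (Continuous.aestronglyMeasurable ?_)
      (Eventually.of_forall fun x => norm_mul_le_decay hb hy hry
        (le_testSeminorm K (N + (n + 1)) φ (by simp [K])))
    refine continuous_iff_continuousAt.2 fun x => ?_
    exact ContinuousAt.comp (f := fun x => cpt x y) (g := fun z => f.1 z * φ.fn z)
      ((hd _ (hmem x y hy hry)).mul φ.mem.1.differentiableAt).continuousAt
      (continuous_cpt y).continuousAt
  -- The bound involves only the values of φ on the slice. This form yields continuity and is also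
  -- the input of the wave packet estimate.
  · have hI : 0 ≤ ∫ x : Fin n → ℝ, decay x := integral_nonneg fun x => (decay_pos x).le
    refine ⟨|M| * Real.exp (l1 y) * ∫ x : Fin n → ℝ, decay x, N + (n + 1), by positivity,
      fun φ S hS => ?_⟩
    refine (norm_integral_le_of_norm_le (integrable_decay.const_mul _)
      (Eventually.of_forall fun x => norm_mul_le_decay hb hy hry (hS x))).trans_eq ?_
    rw [integral_const_mul]
    ring

lemma testSeminorm_withSeminorms (n : ℕ) : WithSeminorms (testSeminorm n) := ⟨rfl⟩

/-- The functional `φ ↦ ∫_{ℝⁿ + i y} f φ` as a tempered ultrahyperfunction. -/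
def sliceFunctional (f : (Fin n → ℂ) → ℂ) (y : Fin n → ℝ)
    (hint : ∀ φ : TestSpace n, Integrable fun x => f (cpt x y) * φ.fn (cpt x y))
    (hb : ∃ (A : ℝ) (N : ℕ), 0 ≤ A ∧ ∀ (φ : TestSpace n) (S : ℝ),
      (∀ x, (1 + l1 (cpt x y)) ^ N * ‖φ.fn (cpt x y)‖ ≤ S) → ‖sliceIntegral f φ y‖ ≤ A * S) :
    TemperedUltrahyperfunction n :=
  let L : TestSpace n →ₗ[ℂ] ℂ :=
    { toFun := fun φ => sliceIntegral f φ y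
      map_add' := fun φ ψ => by
        have h : ∀ x, f (cpt x y) * (φ + ψ).fn (cpt x y) =
            f (cpt x y) * φ.fn (cpt x y) + f (cpt x y) * ψ.fn (cpt x y) :=
          fun x => mul_add _ _ _
        simp only [sliceIntegral, h]
        exact integral_add (hint φ) (hint ψ)
      map_smul' := fun c φ => by
        have h : ∀ x, f (cpt x y) * (c • φ).fn (cpt x y) =
            c * (f (cpt x y) * φ.fn (cpt x y)) := fun x => mul_left_comm _ _ _
        simp only [sliceIntegral, h]
        exact integral_const_mul _ _ }
  ⟨L, by
    obtain ⟨A, N, hA, h⟩ := hb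
    let K : CompactConvexIn (univ : Set (Fin n → ℝ)) :=
      ⟨{y}, isCompact_singleton, convex_singleton y, subset_univ _⟩
    refine (testSeminorm_withSeminorms n).continuous_normedSpace_rng ℂ L
      ⟨{(K, N)}, ⟨A, hA⟩, fun φ => ?_⟩
    rw [Finset.sup_singleton]
    exact h φ _ fun x => le_testSeminorm K N φ (by simp [K])⟩

/-- Existence and uniqueness of the functional represented by an element of `ℋ°_c`. -/
theorem existsUnique_represents {C : Set (Fin n → ℝ)} (hn : 1 ≤ n) (hopen : IsOpen C)
    (hconv : Convex ℝ C) (hcone : IsCone C) (hne : C.Nonempty) (hline : n = 1 → C ≠ univ)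
    (f : HoloSpace C) : ∃! T : TemperedUltrahyperfunction n, Represents C f.1 T := by
  obtain ⟨y₀, hy₀, hy₀'⟩ := exists_ne_zero_mem hn hopen hcone hne
  have hpos := l1_pos hy₀'
  have large : ∀ r : ℝ, ∃ b : ℝ, 0 < b ∧ r < l1 (b • y₀) := by
    intro r
    obtain ⟨b, hb⟩ := exists_gt (max 0 (r / l1 y₀))
    have hb0 : 0 < b := (le_max_left _ _).trans_lt hb
    refine ⟨b, hb0, ?_⟩
    rw [l1_smul hb0.le]
    exact (div_lt_iff₀ hpos).1 ((le_max_right _ _).trans_lt hb)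
  obtain ⟨C₀, hC₀, hC₀y⟩ := exists_compactSubcone hopen hcone (K := {y₀})
    isCompact_singleton (by simpa using hy₀) (by simpa using hy₀'.symm)
  replace hC₀y := hC₀y y₀ rfl
  obtain ⟨r₀, hr₀, hseg₀, hslice₀⟩ := exists_slice_radius f hC₀
  obtain ⟨b₀, hb₀, hrb₀⟩ := large r₀
  obtain ⟨hint₀, hbd₀⟩ := hslice₀ _ (interior_subset (hC₀y b₀ hb₀)) hrb₀
  refine ⟨sliceFunctional f.1 (b₀ • y₀) hint₀ hbd₀, ?_, ?_⟩
  · intro C' hC'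
    obtain ⟨C'', hC'', hsub, hjoin⟩ :=
      exists_joining_subcone hn hopen hconv hcone hline hC' hy₀ hy₀'
    obtain ⟨r, hr, hseg, hslice⟩ := exists_slice_radius f hC''
    refine ⟨r, hr, fun y hy hry φ => ?_⟩
    refine ⟨(hslice y (hsub y hy (ne_zero_of_l1_pos (hr.trans hry))) hry).1 φ, ?_⟩
    -- The two subcones have different radii; a point of the ray of y₀ beyond both links the slice
    -- at y to the reference slice at b₀ • y₀.
    obtain ⟨b, hb, hrb⟩ := large (max r r₀)
    have e1 := hjoin r (sliceIntegral f.1 φ) hr (hseg φ) y hy hry b hb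
      ((le_max_left _ _).trans_lt hrb)
    have e2 := eq_on_rays (k₁ := y₀) (k₂ := y₀) (a := b₀) (b := b) (hseg₀ φ)
      (by
        rw [segment_same]
        rintro p rfl
        exact ⟨hy₀', hC₀y⟩) hb₀ hb hrb₀ ((le_max_right _ _).trans_lt hrb)
    exact e2.trans e1.symm
  · intro T hT
    obtain ⟨r, hr, h⟩ := hT C₀ hC₀
    obtain ⟨b, hb, hrb⟩ := large (max r r₀)
    refine ContinuousLinearMap.ext fun φ => ?_
    rw [(h _ (interior_subset (hC₀y b hb)) ((le_max_left _ _).trans_lt hrb) φ).2]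
    exact eq_on_rays (k₁ := y₀) (k₂ := y₀) (a := b) (b := b₀) (hseg₀ φ)
      (by
        rw [segment_same]
        rintro p rfl
        exact ⟨hy₀', hC₀y⟩) hb hb₀ ((le_max_right _ _).trans_lt hrb) hrb₀

/-! ### The wave front set of the boundary value -/

/-- The open cone `{ξ | ⟨ξ, y⟩ < -δ |ξ|}`. -/
def negCone (y : Fin n → ℝ) (δ : ℝ) : Set (Fin n → ℝ) := {ξ | pair ξ y < -δ * euclid ξ}

lemma isOpen_negCone (y : Fin n → ℝ) (δ : ℝ) : IsOpen (negCone y δ) :=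
  isOpen_lt (continuous_pair_left y) (continuous_const.mul continuous_euclid)

lemma isCone_negCone (y : Fin n → ℝ) (δ : ℝ) : IsCone (negCone y δ) := by
  intro ξ hξ t ht
  change pair (t • ξ) y < -δ * euclid (t • ξ)
  rw [pair_smul_left, euclid_smul ht.le]
  have : pair ξ y < -δ * euclid ξ := hξ
  nlinarith

/-- Taking δ to be half of -⟨ξ, y⟩/‖ξ‖ leaves the inequality strict. -/
lemma exists_mem_negCone {ξ y : Fin n → ℝ} (h : pair ξ y < 0) : ∃ δ > 0, ξ ∈ negCone y δ := by
  have hξ : ξ ≠ 0 := by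
    rintro rfl
    simp [pair] at h
  have hp := euclid_pos hξ
  refine ⟨-pair ξ y / (2 * euclid ξ), div_pos (neg_pos.2 h) (by positivity), ?_⟩
  change pair ξ y < _
  have : -(-pair ξ y / (2 * euclid ξ)) * euclid ξ = pair ξ y / 2 := by field_simp
  rw [this]; linarith

/-- The shift to height y turns the oscillation into the factor exp⟨ξ, y⟩ and costs only exp(c‖y‖²),
from the real part of -c(x - t - iy)². -/
lemma norm_packetFun_cpt (c : ℝ) (x ξ t y : Fin n → ℝ) :
    ‖packetFun c x ξ (cpt t y)‖ =
      Real.exp (pair ξ y + c * euclid y ^ 2 - c * euclid (x - t) ^ 2) := by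
  rw [packetFun, Complex.norm_exp, Complex.re_sum, euclid_sq, euclid_sq, pair, Finset.mul_sum,
    Finset.mul_sum, ← Finset.sum_add_distrib, ← Finset.sum_sub_distrib]
  congr 1
  refine Finset.sum_congr rfl fun j _ => ?_
  simp [pow_two, cpt]
  ring

/-- A Gaussian dominates a power of an affine function. -/
lemma pow_mul_exp_neg_le {a m κ u : ℝ} (ha : 0 ≤ a) (hm : 0 ≤ m) (hκ : 0 < κ) (hu : 0 ≤ u)
    (N : ℕ) : (a + m * u) ^ N * Real.exp (-κ * u ^ 2) ≤
      N.factorial * Real.exp (a + m ^ 2 / (4 * κ)) := by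
  have h1 : (a + m * u) ^ N ≤ N.factorial * Real.exp (a + m * u) := by
    have := Real.pow_div_factorial_le_exp (a + m * u) (by positivity) N
    rwa [div_le_iff₀ (by positivity), mul_comm _ (N.factorial : ℝ)] at this
  have h2 : m * u - κ * u ^ 2 ≤ m ^ 2 / (4 * κ) := by
    rw [le_div_iff₀ (by positivity)]
    nlinarith [sq_nonneg (m - 2 * κ * u)]
  calc (a + m * u) ^ N * Real.exp (-κ * u ^ 2)
      ≤ N.factorial * Real.exp (a + m * u) * Real.exp (-κ * u ^ 2) :=
        mul_le_mul_of_nonneg_right h1 (Real.exp_pos _).le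
    _ = N.factorial * Real.exp (a + m * u + -κ * u ^ 2) := by rw [mul_assoc, ← Real.exp_add]
    _ ≤ _ := by
        refine mul_le_mul_of_nonneg_left (Real.exp_le_exp.2 ?_) (by positivity)
        linarith

/-- A functional which is controlled by the values of the test function on `ℝⁿ + i y` is
microlocally analytic in the directions `ξ` with `⟨ξ, y⟩ < 0`. -/
lemma microAnalyticAt_of_slice_bound {T : TemperedUltrahyperfunction n} {y x₀ ξ₀ : Fin n → ℝ}
    (hξ : pair ξ₀ y < 0) {A : ℝ} {N : ℕ}
    (hT : ∀ (φ : TestSpace n) (S : ℝ),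
      (∀ x, (1 + l1 (cpt x y)) ^ N * ‖φ.fn (cpt x y)‖ ≤ S) → ‖T φ‖ ≤ A * S) :
    MicroAnalyticAt T x₀ ξ₀ := by
  obtain ⟨δ, hδ, hmem⟩ := exists_mem_negCone hξ
  -- With this κ the cost κ‖ξ‖‖y‖² uses at most half of the gain δ‖ξ‖.
  set κ : ℝ := δ / (2 * (euclid y ^ 2 + 1)) with hκdef
  have hκ : 0 < κ := by positivity
  have hκy : κ * euclid y ^ 2 ≤ δ / 2 := by
    have : κ * (euclid y ^ 2 + 1) = δ / 2 := by rw [hκdef]; field_simp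
    nlinarith
  set a : ℝ := 1 + n * (‖x₀‖ + 1) + l1 y with ha
  have ha0 : 0 ≤ a := by have := l1_nonneg y; positivity
  set S : ℝ := N.factorial * Real.exp (a + (n : ℝ) ^ 2 / (4 * κ)) with hS
  refine ⟨κ, hκ, Metric.ball x₀ 1, Metric.ball_mem_nhds _ one_pos, negCone y δ,
    isOpen_negCone y δ, isCone_negCone y δ, hmem, A * S, δ / 2, by positivity, ?_⟩
  intro x hx ξ hΓ hξ1 h
  have hΓ' : pair ξ y < -δ * euclid ξ := hΓ
  have key : ∀ t, (1 + l1 (cpt t y)) ^ N * ‖(packet (κ * euclid ξ) h x ξ).fn (cpt t y)‖ ≤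
      S * Real.exp (-(δ / 2) * euclid ξ) := by
    intro t
    change (1 + l1 (cpt t y)) ^ N * ‖packetFun (κ * euclid ξ) x ξ (cpt t y)‖ ≤ _
    rw [norm_packetFun_cpt]
    have hxn : ‖x‖ ≤ ‖x₀‖ + 1 := by
      have h1 : ‖x - x₀‖ < 1 := by rwa [← dist_eq_norm]
      have h2 := norm_sub_norm_le x x₀
      linarith
    have h1 : 1 + l1 (cpt t y) ≤ a + n * ‖x - t‖ := by
      have h2 := l1_cpt_le t y
      have h3 : ‖t‖ ≤ ‖x‖ + ‖x - t‖ := by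
        have := norm_sub_norm_le t x
        rw [norm_sub_rev] at this
        linarith
      have h4 : (n : ℝ) * ‖t‖ ≤ n * (‖x₀‖ + 1 + ‖x - t‖) :=
        mul_le_mul_of_nonneg_left (by linarith) (Nat.cast_nonneg n)
      rw [ha]; linarith
    have h0 : 0 ≤ 1 + l1 (cpt t y) := by linarith [l1_nonneg (cpt t y)]
    have hsq : ‖x - t‖ ^ 2 ≤ euclid (x - t) ^ 2 :=
      pow_le_pow_left₀ (norm_nonneg _) (norm_le_euclid _) 2
    have hexp : pair ξ y + κ * euclid ξ * euclid y ^ 2 - κ * euclid ξ * euclid (x - t) ^ 2 ≤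
        -κ * ‖x - t‖ ^ 2 + -(δ / 2) * euclid ξ := by
      have e1 : κ * euclid y ^ 2 * euclid ξ ≤ δ / 2 * euclid ξ :=
        mul_le_mul_of_nonneg_right hκy (by linarith)
      -- As ‖ξ‖ ≥ 1, a Gaussian of rate κ independent of ξ survives to absorb the polynomial weight.
      have e2 : κ * ‖x - t‖ ^ 2 ≤ κ * euclid ξ * euclid (x - t) ^ 2 := by
        refine mul_le_mul ?_ hsq (by positivity) h.le
        nlinarith
      linarith
    calc (1 + l1 (cpt t y)) ^ N * Real.exp _
        ≤ (a + n * ‖x - t‖) ^ N *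
          (Real.exp (-κ * ‖x - t‖ ^ 2) * Real.exp (-(δ / 2) * euclid ξ)) := by
          rw [← Real.exp_add]
          exact mul_le_mul (pow_le_pow_left₀ h0 h1 N) (Real.exp_le_exp.2 hexp)
            (Real.exp_pos _).le (by positivity)
      _ ≤ _ := by
          rw [← mul_assoc]
          exact mul_le_mul_of_nonneg_right
            (pow_mul_exp_neg_le ha0 (Nat.cast_nonneg n) hκ (norm_nonneg _) N) (Real.exp_pos _).le
  refine (hT _ _ key).trans_eq ?_
  ring

/-- The wave front set of the functional represented by an element of `ℋ°_c`. -/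
theorem analyticWF_subset_of_represents {C : Set (Fin n → ℝ)} (hopen : IsOpen C)
    (hcone : IsCone C) (f : HoloSpace C) {T : TemperedUltrahyperfunction n}
    (hT : Represents C f.1 T) : analyticWF T ⊆ univ ×ˢ dualCone C := by
  rintro ⟨x₀, ξ₀⟩ ⟨-, hWF⟩
  refine ⟨mem_univ _, ?_⟩
  by_contra hξ
  simp only [dualCone, mem_ofPred_eq, not_forall, not_le] at hξ
  obtain ⟨y₀, hy₀, hlt⟩ := hξ
  have hy₀' : y₀ ≠ 0 := by
    rintro rfl
    simp [pair] at hlt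
  obtain ⟨C₀, hC₀, hC₀y⟩ := exists_compactSubcone hopen hcone (K := {y₀})
    isCompact_singleton (by simpa using hy₀) (by simpa using hy₀'.symm)
  obtain ⟨r, hr, -, hslice⟩ := exists_slice_radius f hC₀
  obtain ⟨r', hr', hrep⟩ := hT C₀ hC₀
  -- Scaling y₀ by b > 0 keeps the pairing with ξ₀ negative while moving the slice beyond both
  -- radii.
  obtain ⟨b, hb⟩ := exists_gt (max r r' / l1 y₀)
  have hb0 : 0 < b := lt_of_le_of_lt (div_nonneg (hr.le.trans (le_max_left _ _)) (l1_nonneg _)) hb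
  have hbl : max r r' < l1 (b • y₀) := by
    rw [l1_smul hb0.le]
    exact (div_lt_iff₀ (l1_pos hy₀')).1 hb
  have hmem := interior_subset (hC₀y y₀ rfl b hb0)
  obtain ⟨-, A, N, -, hbd⟩ := hslice _ hmem ((le_max_left _ _).trans_lt hbl)
  refine hWF (microAnalyticAt_of_slice_bound (y := b • y₀) (A := A) (N := N) ?_
    fun φ S hS => ?_)
  · rw [pair_smul_right]
    exact mul_neg_of_pos_of_neg hb0 hlt
  · rw [(hrep _ hmem ((le_max_right _ _).trans_lt hbl) φ).2]
    exact hbd φ S hS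

/-! ### Derivatives of exponentials of quadratic polynomials -/

/-- The real derivative of exp is multiplication by exp, and w ↦ (v ↦ wv) has norm at most 1, so
induction loses no constant. -/
lemma norm_iteratedFDeriv_cexp_le (i : ℕ) (w : ℂ) :
    ‖iteratedFDeriv ℝ i Complex.exp w‖ ≤ ‖Complex.exp w‖ := by
  induction i with
  | zero => simp
  | succ i ih =>
    have h : fderiv ℝ Complex.exp = (ContinuousLinearMap.mul ℝ ℂ) ∘ Complex.exp := by
      funext w
      have h1 := ((Complex.hasDerivAt_exp w).hasFDerivAt.restrictScalars ℝ).fderiv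
      rw [h1]
      ext v
      simp [mul_comm]
    rw [← norm_iteratedFDeriv_fderiv, h]
    have h2 : ContDiffAt ℝ i Complex.exp w := Complex.contDiff_exp.contDiffAt
    refine ((ContinuousLinearMap.mul ℝ ℂ).norm_iteratedFDeriv_comp_left h2 le_rfl).trans ?_
    calc _ ≤ 1 * ‖iteratedFDeriv ℝ i Complex.exp w‖ :=
          mul_le_mul_of_nonneg_right (ContinuousLinearMap.opNorm_mul_le ℝ ℂ) (norm_nonneg _)
      _ ≤ _ := by rw [one_mul]; exact ih

/-- A constant second derivative makes all later ones vanish. -/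
lemma norm_iteratedFDeriv_add_two_le {E F : Type*} [NormedAddCommGroup E] [NormedSpace ℝ E]
    [NormedAddCommGroup F] [NormedSpace ℝ F] {q : E → F} {L : E →L[ℝ] E →L[ℝ] F}
    (h : ∀ η, HasFDerivAt (fderiv ℝ q) L η) (i : ℕ) (η : E) :
    ‖iteratedFDeriv ℝ (i + 2) q η‖ ≤ ‖L‖ := by
  rw [← norm_iteratedFDeriv_fderiv, ← norm_iteratedFDeriv_fderiv,
    show fderiv ℝ (fderiv ℝ q) = fun _ => L from funext fun η => (h η).fderiv]
  rcases Nat.eq_zero_or_pos i with rfl | hi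
  · simp
  · rw [iteratedFDeriv_const_of_ne hi.ne']
    rw [Pi.zero_apply, norm_zero]
    exact norm_nonneg L

/-- The Faà di Bruno bound asks for ‖Dⁱq‖ ≤ Dⁱ. For quadratic q this is the gradient bound when i =
1, and for i ≥ 2 it follows from ‖L‖ ≤ D ≤ Dⁱ, as D ≥ 1. -/
lemma norm_iteratedFDeriv_cexp_comp_le {E : Type*} [NormedAddCommGroup E] [NormedSpace ℝ E]
    {q : E → ℂ} {L : E →L[ℝ] E →L[ℝ] ℂ} (hq : ContDiff ℝ ∞ q)
    (h : ∀ η, HasFDerivAt (fderiv ℝ q) L η) {D : ℝ} {η : E} (hD1 : 1 ≤ D)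
    (hDq : ‖fderiv ℝ q η‖ ≤ D) (hDL : ‖L‖ ≤ D) (m : ℕ) :
    ‖iteratedFDeriv ℝ m (fun η => Complex.exp (q η)) η‖ ≤
      m.factorial * ‖Complex.exp (q η)‖ * D ^ m := by
  refine norm_iteratedFDeriv_comp_le (g := Complex.exp) (f := q) (N := ∞)
    Complex.contDiff_exp hq (by exact_mod_cast le_top) η
    (fun i _ => norm_iteratedFDeriv_cexp_le i _) fun i hi _ => ?_
  obtain rfl | ⟨k, rfl⟩ : i = 1 ∨ ∃ k, i = k + 2 := by
    rcases i with _ | _ | k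
    · omega
    · exact Or.inl rfl
    · exact Or.inr ⟨k, rfl⟩
  · rw [pow_one]
    have := norm_iteratedFDeriv_fderiv (𝕜 := ℝ) (f := q) (x := η) (n := 0)
    rw [← this]
    simpa using hDq
  · exact (norm_iteratedFDeriv_add_two_le h k η).trans
      (hDL.trans (le_self_pow₀ hD1 (by omega)))

/-- The coordinate `η ↦ η_j` as a complex-valued map. -/
def coordC (j : Fin n) : (Fin n → ℝ) →L[ℝ] ℂ := Complex.ofRealCLM.comp (ContinuousLinearMap.proj j)

@[simp] lemma coordC_apply (j : Fin n) (η : Fin n → ℝ) : coordC j η = (η j : ℂ) := rfl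

lemma norm_coordC_le (j : Fin n) : ‖coordC j‖ ≤ 1 :=
  ContinuousLinearMap.opNorm_le_bound _ zero_le_one fun η => by
    simpa using norm_le_pi_norm η j

/-- The exponent of the Fourier transform of a wave packet. -/
def packetExponent (c : ℝ) (x ξ η : Fin n → ℝ) : ℂ :=
  ∑ j, (Complex.I * x j * η j - ((ξ j : ℂ) - η j) ^ 2 / (4 * c))

lemma contDiff_packetExponent (c : ℝ) (x ξ : Fin n → ℝ) :
    ContDiff ℝ ∞ (packetExponent c x ξ) := by
  have h : packetExponent c x ξ =
      fun η => ∑ j, (Complex.I * x j * coordC j η - ((ξ j : ℂ) - coordC j η) ^ 2 / (4 * c)) := rfl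
  rw [h]
  fun_prop

lemma hasFDerivAt_packetExponent {c : ℝ} (x ξ η : Fin n → ℝ) :
    HasFDerivAt (packetExponent c x ξ)
      (∑ j, (Complex.I * x j + ((ξ j : ℂ) - η j) / (2 * c)) • coordC j) η := by
  unfold packetExponent
  refine HasFDerivAt.fun_sum fun j _ => ?_
  have h1 : HasDerivAt (fun w : ℂ => Complex.I * x j * w - ((ξ j : ℂ) - w) ^ 2 / (4 * c))
      (Complex.I * x j + ((ξ j : ℂ) - η j) / (2 * c)) (coordC j η) := by
    have h2 := ((hasDerivAt_id (coordC j η)).const_mul (Complex.I * x j)).sub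
      ((((hasDerivAt_id (coordC j η)).const_sub (ξ j : ℂ)).pow 2).div_const (4 * c : ℂ))
    refine h2.congr_deriv ?_
    simp
    ring
  refine ((h1.hasFDerivAt.restrictScalars ℝ).comp η (coordC j).hasFDerivAt).congr_fderiv ?_
  ext v
  simp [mul_comm]

/-- The second derivative of `packetExponent`. -/
def packetHessian (n : ℕ) (c : ℝ) : (Fin n → ℝ) →L[ℝ] (Fin n → ℝ) →L[ℝ] ℂ :=
  ∑ j, (coordC j).smulRight (-(1 / (2 * c) : ℝ) • coordC j : (Fin n → ℝ) →L[ℝ] ℂ)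

lemma fderiv_packetExponent (c : ℝ) (x ξ : Fin n → ℝ) :
    fderiv ℝ (packetExponent c x ξ) = fun η =>
      ∑ j, (Complex.I * x j + ((ξ j : ℂ) - η j) / (2 * c)) • coordC j :=
  funext fun η => (hasFDerivAt_packetExponent x ξ η).fderiv

lemma hasFDerivAt_fderiv_packetExponent (c : ℝ) (x ξ η : Fin n → ℝ) :
    HasFDerivAt (fderiv ℝ (packetExponent c x ξ)) (packetHessian n c) η := by
  rw [fderiv_packetExponent]
  refine HasFDerivAt.fun_sum fun j _ => ?_
  have h1 : HasFDerivAt (fun η : Fin n → ℝ => Complex.I * x j + ((ξ j : ℂ) - η j) / (2 * c))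
      (-(1 / (2 * c) : ℝ) • coordC j : (Fin n → ℝ) →L[ℝ] ℂ) η := by
    have h2 := ((((coordC j).hasFDerivAt (x := η)).const_sub (ξ j : ℂ)).mul_const
      ((2 * c : ℂ)⁻¹)).const_add (Complex.I * x j)
    refine h2.congr_fderiv ?_
    ext v
    simp
  refine (h1.smul_const (coordC j)).congr_fderiv ?_
  ext v w
  simp
  ring

lemma norm_packetHessian_le {c : ℝ} (hc : 0 < c) : ‖packetHessian n c‖ ≤ n / (2 * c) := by
  have h : ∀ j : Fin n,
      ‖(coordC j).smulRight (-(1 / (2 * c) : ℝ) • coordC j : (Fin n → ℝ) →L[ℝ] ℂ)‖ ≤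
        1 / (2 * c) := by
    intro j
    refine ContinuousLinearMap.opNorm_le_bound _ (by positivity) fun v => ?_
    rw [ContinuousLinearMap.smulRight_apply, norm_smul, norm_smul, norm_neg,
      Real.norm_of_nonneg (by positivity), coordC_apply, Complex.norm_real, mul_comm]
    have h1 := norm_coordC_le j
    have h2 := norm_le_pi_norm v j
    calc 1 / (2 * c) * ‖coordC j‖ * ‖v j‖ ≤ 1 / (2 * c) * 1 * ‖v‖ := by gcongr
      _ = _ := by ring
  unfold packetHessian
  refine (norm_sum_le Finset.univ fun j => (coordC j).smulRight
    (-(1 / (2 * c) : ℝ) • coordC j : (Fin n → ℝ) →L[ℝ] ℂ)).trans ((Finset.sum_le_sum fun j _ => h j).trans_eq ?_)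
  simp
  ring

lemma norm_fderiv_packetExponent_le {c : ℝ} (hc : 0 < c) (x ξ η : Fin n → ℝ) :
    ‖fderiv ℝ (packetExponent c x ξ) η‖ ≤ n * (‖x‖ + ‖ξ - η‖ / (2 * c)) := by
  have h : ∀ j : Fin n, ‖(Complex.I * x j + ((ξ j : ℂ) - η j) / (2 * c)) • coordC j‖ ≤
      ‖x‖ + ‖ξ - η‖ / (2 * c) := by
    intro j
    rw [norm_smul]
    refine (mul_le_of_le_one_right (norm_nonneg _) (norm_coordC_le j)).trans ?_
    refine (norm_add_le _ _).trans (add_le_add ?_ ?_)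
    · simpa using norm_le_pi_norm x j
    · rw [norm_div, ← Complex.ofReal_sub, Complex.norm_real, norm_mul, Complex.norm_real,
        Real.norm_of_nonneg hc.le, Complex.norm_ofNat]
      have := norm_le_pi_norm (ξ - η) j
      rw [Pi.sub_apply] at this
      gcongr
  rw [fderiv_packetExponent]
  refine (norm_sum_le _ _).trans ((Finset.sum_le_sum fun j _ => h j).trans_eq ?_)
  simp [mul_add]

/-- The centre x enters only through a phase, so the modulus does not depend on it. -/
lemma norm_cexp_packetExponent (c : ℝ) (x ξ η : Fin n → ℝ) :
    ‖Complex.exp (packetExponent c x ξ η)‖ = Real.exp (-(euclid (ξ - η) ^ 2 / (4 * c))) := by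
  rw [Complex.norm_exp, packetExponent, Complex.re_sum, euclid_sq, Finset.sum_div,
    ← Finset.sum_neg_distrib]
  congr 1
  refine Finset.sum_congr rfl fun j _ => ?_
  have h : Complex.I * x j * η j - ((ξ j : ℂ) - η j) ^ 2 / (4 * c) =
      Complex.I * ((x j * η j : ℝ) : ℂ) - (((ξ j - η j) ^ 2 / (4 * c) : ℝ) : ℂ) := by
    push_cast; ring
  rw [h, Complex.sub_re, Complex.ofReal_re]
  simp

/-- The Fourier transform of a wave packet. -/
lemma fourier_packetFun {c : ℝ} (hc : 0 < c) (x ξ η : Fin n → ℝ) :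
    fourier (fun t => packetFun c x ξ (cpt t 0)) η =
      (((Real.pi / c : ℝ) : ℂ) ^ (1 / 2 : ℂ)) ^ n * Complex.exp (packetExponent c x ξ η) := by
  have hc' : (c : ℂ) ≠ 0 := by exact_mod_cast hc.ne'
  -- The integrand is a Gaussian with linear coefficient 2cx + i(η - ξ), times a constant. The
  -- square of that coefficient over 4c, added to ixξ - cx², is the exponent ixη - (ξ - η)²/(4c).
  have h1 : ∀ t : Fin n → ℝ,
      packetFun c x ξ (cpt t 0) * Complex.exp (Complex.I * (pair η t : ℂ)) =
      Complex.exp (-∑ j, (c : ℂ) * (t j : ℂ) ^ 2 +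
        ∑ j, (2 * c * x j + Complex.I * (η j - ξ j)) * (t j : ℂ)) *
        Complex.exp (∑ j, (Complex.I * x j * ξ j - c * (x j : ℂ) ^ 2)) := by
    intro t
    rw [packetFun, ← Complex.exp_add, ← Complex.exp_add, pair]
    congr 1
    push_cast
    rw [Finset.mul_sum, ← Finset.sum_neg_distrib, ← Finset.sum_add_distrib,
      ← Finset.sum_add_distrib, ← Finset.sum_add_distrib]
    refine Finset.sum_congr rfl fun j _ => ?_
    simp [cpt]
    ring
  rw [fourier]
  simp only [h1]
  rw [integral_mul_const, GaussianFourier.integral_cexp_neg_sum_mul_add (b := fun _ => (c : ℂ))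
    (fun _ => by simpa using hc), Finset.prod_mul_distrib, ← Complex.exp_sum, mul_assoc,
    ← Complex.exp_add, ← Finset.sum_add_distrib, Finset.prod_const, Finset.card_univ,
    Fintype.card_fin, packetExponent]
  push_cast
  congr 2
  refine Finset.sum_congr rfl fun j _ => ?_
  field_simp
  linear_combination ((η j : ℂ) - ξ j) ^ 2 * Complex.I_sq

/-! ### Cutoff functions -/

/-- A smooth function with compact support in `{⟨η, y⟩ < 0}` which is one on a truncated cone. -/
lemma exists_cutoff (y : Fin n → ℝ) {δ : ℝ} (hδ : 0 < δ) :
    ∃ b : (Fin n → ℝ) → ℝ, ContDiff ℝ ∞ b ∧ HasCompactSupport b ∧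
      tsupport b ⊆ {η | pair η y ≤ -(δ / 4)} ∧
      ∀ η, ‖η‖ ≤ 2 → pair η y ≤ -(δ / 2) → b η = 1 := by
  let β : ContDiffBump (0 : Fin n → ℝ) := ⟨2, 3, by norm_num, by norm_num⟩
  -- This affine function of ⟨η, y⟩ is ≤ 0 above -δ/4 and ≥ 1 below -δ/2, the two thresholds of
  -- `Real.smoothTransition`.
  have hlin : ContDiff ℝ ∞ fun η : Fin n → ℝ => -(4 / δ) * pair η y - 1 := by
    unfold pair; fun_prop
  refine ⟨fun η => β η * Real.smoothTransition (-(4 / δ) * pair η y - 1),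
    β.contDiff.mul (Real.smoothTransition.contDiff.comp hlin), β.hasCompactSupport.mul_right,
    closure_minimal ?_ (isClosed_le (continuous_pair_left y) continuous_const), ?_⟩
  · intro η hη
    by_contra h
    refine hη ?_
    have h1 : -(δ / 4) < pair η y := not_le.1 h
    have h2 : -(4 / δ) * pair η y - 1 ≤ 0 := by
      have : -(4 / δ) * pair η y - 1 = -(4 / δ) * (pair η y + δ / 4) := by field_simp; ring
      rw [this]
      exact mul_nonpos_of_nonpos_of_nonneg (neg_nonpos.2 (by positivity)) (by linarith)
    change β η * Real.smoothTransition (-(4 / δ) * pair η y - 1) = 0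
    rw [Real.smoothTransition.zero_of_nonpos h2, mul_zero]
  · intro η hη hp
    have h1 : β η = 1 := β.one_of_mem_closedBall (mem_closedBall_zero_iff.2 hη)
    have h2 : 1 ≤ -(4 / δ) * pair η y - 1 := by
      have : -(4 / δ) * pair η y - 1 = 1 + (4 / δ) * (-(δ / 2) - pair η y) := by
        field_simp; ring
      rw [this]
      have : 0 ≤ (4 / δ) * (-(δ / 2) - pair η y) := mul_nonneg (by positivity) (by linarith)
      linarith
    change β η * Real.smoothTransition (-(4 / δ) * pair η y - 1) = 1
    rw [h1, Real.smoothTransition.one_of_one_le h2, mul_one]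

/-- The derivatives of `1 - b(η / t)`, `t ≥ 1`, are bounded uniformly in `t`. -/
lemma exists_bound_iteratedFDeriv_cutoff {b : (Fin n → ℝ) → ℝ} (hb : ContDiff ℝ ∞ b)
    (hc : HasCompactSupport b) : ∃ B : ℕ → ℝ, ∀ m, ∀ t : ℝ, 1 ≤ t → ∀ η,
      ‖iteratedFDeriv ℝ m (fun η => 1 - b (t⁻¹ • η)) η‖ ≤ B m := by
  have h : ∀ m, ∃ B : ℝ, ∀ η, ‖iteratedFDeriv ℝ m b η‖ ≤ B := fun m =>
    (hc.iteratedFDeriv m).exists_bound_of_continuous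
      (hb.continuous_iteratedFDeriv (by exact_mod_cast le_top))
  choose B hB using h
  refine ⟨fun m => 1 + B m, fun m t ht η => ?_⟩
  have hbt : ContDiff ℝ ∞ fun η => b (t⁻¹ • η) := hb.comp (contDiff_const_smul _)
  have hle : (m : WithTop ℕ∞) ≤ ∞ := by exact_mod_cast le_top
  have e : (fun η => 1 - b (t⁻¹ • η)) = (fun _ : Fin n → ℝ => (1 : ℝ)) - fun η => b (t⁻¹ • η) := rfl
  rw [e, iteratedFDeriv_sub_apply contDiffAt_const (hbt.contDiffAt.of_le hle)]
  refine (norm_sub_le _ _).trans (add_le_add ?_ ?_)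
  · rcases Nat.eq_zero_or_pos m with rfl | hm
    · simp
    · rw [iteratedFDeriv_const_of_ne hm.ne', Pi.zero_apply, norm_zero]
      exact zero_le_one
  · rw [iteratedFDeriv_comp_const_smul _ (hb.of_le hle), norm_smul, norm_pow, norm_inv,
      Real.norm_of_nonneg (by linarith)]
    exact (mul_le_of_le_one_left (norm_nonneg _)
      (pow_le_one₀ (by positivity) (inv_le_one_of_one_le₀ ht))).trans (hB m _)

/-! ### Exponential decay of the packet away from its centre -/

/-- The Fourier transform of a wave packet, cut off near its centre. -/
def cutPacket (b : (Fin n → ℝ) → ℝ) (t c : ℝ) (x ξ η : Fin n → ℝ) : ℂ :=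
  (1 - b (t⁻¹ • η)) • Complex.exp (packetExponent c x ξ η)

/-- Leibniz' rule, with D dominating both the gradient and the Hessian of the exponent. `M` depends
only on m and b, since dilating the cutoff by t ≥ 1 does not enlarge its derivatives. -/
lemma exists_norm_iteratedFDeriv_cutPacket_le {b : (Fin n → ℝ) → ℝ} (hb : ContDiff ℝ ∞ b)
    (hc : HasCompactSupport b) (m : ℕ) : ∃ M : ℝ, 0 ≤ M ∧ ∀ t c D : ℝ, 1 ≤ t → 0 < c → 1 ≤ D →
      ∀ x ξ η, n * (‖x‖ + ‖ξ - η‖ / (2 * c)) ≤ D → n / (2 * c) ≤ D →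
        ‖iteratedFDeriv ℝ m (cutPacket b t c x ξ) η‖ ≤
          M * D ^ m * Real.exp (-(euclid (ξ - η) ^ 2 / (4 * c))) := by
  obtain ⟨B, hB⟩ := exists_bound_iteratedFDeriv_cutoff hb hc
  have hB0 : ∀ i, 0 ≤ B i := fun i => (norm_nonneg _).trans (hB i 1 le_rfl 0)
  refine ⟨∑ i ∈ Finset.range (m + 1), m.choose i * B i * (m - i).factorial,
    Finset.sum_nonneg fun i _ => by have := hB0 i; positivity, ?_⟩
  intro t c D ht hc0 hD x ξ η h1 h2
  have hbt : ContDiff ℝ ∞ fun η => 1 - b (t⁻¹ • η) :=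
    contDiff_const.sub (hb.comp (contDiff_const_smul _))
  have hexp : ContDiff ℝ ∞ fun η => Complex.exp (packetExponent c x ξ η) :=
    Complex.contDiff_exp.comp (contDiff_packetExponent c x ξ)
  refine (norm_iteratedFDeriv_smul_le hbt hexp η (n := m) (by exact_mod_cast le_top)).trans ?_
  rw [Finset.sum_mul, Finset.sum_mul]
  refine Finset.sum_le_sum fun i hi => ?_
  have h3 := norm_iteratedFDeriv_cexp_comp_le (contDiff_packetExponent c x ξ)
    (hasFDerivAt_fderiv_packetExponent c x ξ) hD
    ((norm_fderiv_packetExponent_le hc0 x ξ η).trans h1)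
    ((norm_packetHessian_le hc0).trans h2) (m - i)
  rw [norm_cexp_packetExponent] at h3
  have h4 : D ^ (m - i) ≤ D ^ m := pow_le_pow_right₀ hD (Nat.sub_le _ _)
  have h5 := hB i t ht η
  have h6 := hB0 i
  calc _ ≤ m.choose i * B i * ((m - i).factorial *
        Real.exp (-(euclid (ξ - η) ^ 2 / (4 * c))) * D ^ m) := by
        refine mul_le_mul (mul_le_mul_of_nonneg_left h5 (Nat.cast_nonneg _)) (h3.trans ?_)
          (norm_nonneg _) (by positivity)
        exact mul_le_mul_of_nonneg_left h4 (by positivity)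
    _ = _ := by ring

/-- Off the truncated cone where the cutoff is one, `ξ - η` is comparable to `|ξ| + |η|`. -/
lemma add_le_mul_norm_sub {y ξ η : Fin n → ℝ} {δ : ℝ} (hδ : 0 < δ) (hξ : ξ ∈ negCone y δ)
    (h : 2 * euclid ξ ≤ ‖η‖ ∨ -(δ / 2) * euclid ξ ≤ pair η y) :
    euclid ξ + ‖η‖ ≤ (3 + 4 * l1 y / δ) * ‖ξ - η‖ := by
  have h1 : ‖η‖ ≤ ‖ξ‖ + ‖ξ - η‖ := by
    have := norm_sub_norm_le η ξ
    rw [norm_sub_rev] at this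
    linarith
  have h2 := norm_le_euclid ξ
  have h0 := norm_nonneg (ξ - η)
  have hl := l1_nonneg y
  have h3 : 0 ≤ 4 * l1 y / δ * ‖ξ - η‖ := by positivity
  -- In the first case ‖ξ‖ ≤ ‖ξ - η‖ and ‖η‖ ≤ 2‖ξ - η‖, whence the 3. In the second, ⟨η - ξ, y⟩ >
  -- (δ/2)‖ξ‖ forces ‖ξ‖ ≤ (2|y|/δ)‖ξ - η‖, whence the other term.
  rcases h with h | h
  · nlinarith
  · have h4 : pair ξ y < -δ * euclid ξ := hξ
    have h5 : pair η y - pair ξ y ≤ ‖ξ - η‖ * l1 y := by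
      rw [← pair_sub_left, norm_sub_rev]
      exact (le_abs_self _).trans (abs_pair_le _ _)
    have h6 : euclid ξ ≤ 2 * l1 y / δ * ‖ξ - η‖ := by
      rw [div_mul_eq_mul_div, le_div_iff₀ hδ]
      nlinarith
    have h7 : 4 * l1 y / δ * ‖ξ - η‖ = 2 * (2 * l1 y / δ * ‖ξ - η‖) := by ring
    nlinarith

set_option maxHeartbeats 800000 in
/-- Exponential decay of the derivatives of the cut off packet. -/
lemma exists_cutPacket_decay {b : (Fin n → ℝ) → ℝ} (hb : ContDiff ℝ ∞ b)
    (hc : HasCompactSupport b) {y : Fin n → ℝ} {δ : ℝ} (hδ : 0 < δ)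
    (hb1 : ∀ η, ‖η‖ ≤ 2 → pair η y ≤ -(δ / 2) → b η = 1) (x₀ : Fin n → ℝ) {R : ℝ} (hR : 0 ≤ R) :
    ∃ κ : ℝ, 0 < κ ∧ ∀ m : ℕ, ∃ M : ℝ, 0 ≤ M ∧ ∀ x ∈ Metric.ball x₀ 1, ∀ ξ ∈ negCone y δ,
      1 ≤ euclid ξ → ∀ η, Real.exp (R * ‖η‖) *
        ‖iteratedFDeriv ℝ m (cutPacket b (euclid ξ) (κ * euclid ξ) x ξ) η‖ ≤
          M * Real.exp (-1 * euclid ξ) := by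
  have hl := l1_nonneg y
  set B : ℝ := 3 + 4 * l1 y / δ with hBdef
  have hB : 0 < B := by positivity
  -- Chosen so that ‖ξ - η‖ ≥ (‖ξ‖ + ‖η‖)/B makes the Gaussian exponent at least (R + 1)(‖ξ‖ +
  -- ‖η‖)²/‖ξ‖.
  set κ : ℝ := 1 / (4 * B ^ 2 * (R + 1)) with hκdef
  have hκ : 0 < κ := by positivity
  refine ⟨κ, hκ, fun m => ?_⟩
  obtain ⟨M, hM0, hM⟩ := exists_norm_iteratedFDeriv_cutPacket_le hb hc m
  set D₀ : ℝ := 1 + n * (‖x₀‖ + 1) + n / (2 * κ) with hD₀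
  have hD₀1 : 1 ≤ D₀ := by
    have : 0 ≤ n * (‖x₀‖ + 1) + n / (2 * κ) := by positivity
    linarith
  have hM' : 0 ≤ M * D₀ ^ m * (m.factorial * Real.exp 1) := by positivity
  refine ⟨M * D₀ ^ m * (m.factorial * Real.exp 1), hM', ?_⟩
  intro x hx ξ hξ hξ1 η
  by_cases h : 2 * euclid ξ ≤ ‖η‖ ∨ -(δ / 2) * euclid ξ ≤ pair η y
  · have hlow := add_le_mul_norm_sub hδ hξ h
    have hxn : ‖x‖ ≤ ‖x₀‖ + 1 := by
      have h1 : ‖x - x₀‖ < 1 := by rwa [← dist_eq_norm]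
      have h2 := norm_sub_norm_le x x₀
      linarith
    have hpos : 0 < euclid ξ := by linarith
    have hη := norm_nonneg η
    have hD1 : 1 ≤ D₀ * (1 + ‖η‖) := by nlinarith
    -- Since ‖ξ‖ ≥ 1, the gradient of the exponent grows only like 1 + ‖η‖, uniformly in ξ.
    have hq : ‖ξ - η‖ / (2 * (κ * euclid ξ)) ≤ (1 + ‖η‖) / (2 * κ) := by
      rw [div_le_div_iff₀ (by positivity) (by positivity)]
      have h1 : ‖ξ - η‖ ≤ (1 + ‖η‖) * euclid ξ := by
        have := norm_sub_le ξ η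
        have := norm_le_euclid ξ
        nlinarith
      nlinarith
    have hn : (0 : ℝ) ≤ n := Nat.cast_nonneg n
    have hDq : n * (‖x‖ + ‖ξ - η‖ / (2 * (κ * euclid ξ))) ≤ D₀ * (1 + ‖η‖) := by
      have h1 : ‖x‖ ≤ (‖x₀‖ + 1) * (1 + ‖η‖) := by nlinarith [norm_nonneg x₀]
      calc n * (‖x‖ + ‖ξ - η‖ / (2 * (κ * euclid ξ)))
          ≤ n * ((‖x₀‖ + 1) * (1 + ‖η‖) + (1 + ‖η‖) / (2 * κ)) := by gcongr
        _ = (D₀ - 1) * (1 + ‖η‖) := by rw [hD₀]; ring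
        _ ≤ _ := by nlinarith
    have hDL : n / (2 * (κ * euclid ξ)) ≤ D₀ * (1 + ‖η‖) := by
      have h1 : n / (2 * (κ * euclid ξ)) ≤ n / (2 * κ) := by
        refine div_le_div_of_nonneg_left hn (by positivity) ?_
        nlinarith
      have h2 : (0 : ℝ) ≤ n * (‖x₀‖ + 1) := by positivity
      have h3 : n / (2 * κ) ≤ D₀ := by rw [hD₀]; linarith
      nlinarith
    have hbound := hM (euclid ξ) (κ * euclid ξ) (D₀ * (1 + ‖η‖)) hξ1 (by positivity) hD1 x ξ η
      hDq hDL
    have hpow : (1 + ‖η‖) ^ m ≤ m.factorial * Real.exp (1 + ‖η‖) := by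
      have := Real.pow_div_factorial_le_exp (1 + ‖η‖) (by positivity) m
      rwa [div_le_iff₀ (by positivity), mul_comm _ (m.factorial : ℝ)] at this
    -- Uses (‖ξ‖ + ‖η‖)² ≥ ‖ξ‖(‖ξ‖ + 2‖η‖). The resulting linear exponent covers the weight R‖η‖,
    -- the loss 1 + ‖η‖ from the polynomial factor, and the decay rate 1 in ‖ξ‖, up to the constant
    -- e.
    have hgauss : (R + 1) * (euclid ξ + 2 * ‖η‖) ≤ euclid (ξ - η) ^ 2 / (4 * (κ * euclid ξ)) := by
      rw [le_div_iff₀ (by positivity)]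
      have h1 : (euclid ξ + ‖η‖) ^ 2 ≤ B ^ 2 * euclid (ξ - η) ^ 2 := by
        rw [← mul_pow]
        exact pow_le_pow_left₀ (by positivity)
          (hlow.trans (mul_le_mul_of_nonneg_left (norm_le_euclid _) hB.le)) 2
      have h2 : (R + 1) * (euclid ξ + 2 * ‖η‖) * (4 * (κ * euclid ξ)) =
          (euclid ξ + 2 * ‖η‖) * euclid ξ / B ^ 2 := by
        rw [hκdef]; field_simp
      rw [h2, div_le_iff₀ (by positivity)]
      have e : (euclid ξ + 2 * ‖η‖) * euclid ξ = (euclid ξ + ‖η‖) ^ 2 - ‖η‖ ^ 2 := by ring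
      linarith [sq_nonneg ‖η‖]
    have hexp : R * ‖η‖ + (1 + ‖η‖) + -(euclid (ξ - η) ^ 2 / (4 * (κ * euclid ξ))) ≤
        1 + -1 * euclid ξ := by
      have e : (R + 1) * (euclid ξ + 2 * ‖η‖) =
          R * euclid ξ + euclid ξ + 2 * (R * ‖η‖) + 2 * ‖η‖ := by ring
      linarith [mul_nonneg hR hη, mul_nonneg hR hpos.le]
    calc Real.exp (R * ‖η‖) *
          ‖iteratedFDeriv ℝ m (cutPacket b (euclid ξ) (κ * euclid ξ) x ξ) η‖
        ≤ Real.exp (R * ‖η‖) * (M * (D₀ * (1 + ‖η‖)) ^ m *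
          Real.exp (-(euclid (ξ - η) ^ 2 / (4 * (κ * euclid ξ))))) :=
          mul_le_mul_of_nonneg_left hbound (Real.exp_pos _).le
      _ = M * D₀ ^ m * ((1 + ‖η‖) ^ m * (Real.exp (R * ‖η‖) *
          Real.exp (-(euclid (ξ - η) ^ 2 / (4 * (κ * euclid ξ)))))) := by
          rw [mul_pow]; ring
      _ ≤ M * D₀ ^ m * (m.factorial * Real.exp (1 + ‖η‖) * (Real.exp (R * ‖η‖) *
          Real.exp (-(euclid (ξ - η) ^ 2 / (4 * (κ * euclid ξ)))))) := by
          gcongr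
      _ = M * D₀ ^ m * (m.factorial * Real.exp (R * ‖η‖ + (1 + ‖η‖) +
          -(euclid (ξ - η) ^ 2 / (4 * (κ * euclid ξ))))) := by
          rw [Real.exp_add (R * ‖η‖ + (1 + ‖η‖)), Real.exp_add (R * ‖η‖) (1 + ‖η‖)]; ring
      _ ≤ M * D₀ ^ m * (m.factorial * Real.exp (1 + -1 * euclid ξ)) := by
          gcongr
      _ = _ := by rw [Real.exp_add]; ring
  · push Not at h
    have hpos : 0 < euclid ξ := by linarith
    -- In the remaining region the cutoff is one on a whole neighbourhood, so the derivatives of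
    -- every order vanish too.
    have hzero : cutPacket b (euclid ξ) (κ * euclid ξ) x ξ =ᶠ[𝓝 η] fun _ => 0 := by
      have ho : IsOpen {η : Fin n → ℝ | ‖η‖ < 2 * euclid ξ ∧ pair η y < -(δ / 2) * euclid ξ} :=
        (isOpen_lt continuous_norm continuous_const).inter
          (isOpen_lt (continuous_pair_left y) continuous_const)
      filter_upwards [ho.mem_nhds h] with η' hη'
      rw [cutPacket, hb1, sub_self, zero_smul]
      · rw [norm_smul, norm_inv, Real.norm_of_nonneg hpos.le, inv_mul_le_iff₀ hpos]
        linarith [hη'.1]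
      · rw [pair_smul_left, inv_mul_le_iff₀ hpos]
        linarith [hη'.2]
    have h0 : iteratedFDeriv ℝ m (cutPacket b (euclid ξ) (κ * euclid ξ) x ξ) η = 0 := by
      rw [(hzero.iteratedFDeriv ℝ m).eq_of_nhds, iteratedFDeriv_fun_zero, Pi.zero_apply]
    rw [h0, norm_zero, mul_zero]
    exact mul_nonneg hM' (Real.exp_pos _).le

/-! ### Distributions of exponential growth -/

lemma expSeminorm_withSeminorms (O : Set (Fin n → ℝ)) : WithSeminorms (expSeminorm O) := ⟨rfl⟩

/-- Continuity involves finitely many seminorms, so only finitely many compact sets and orders of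
differentiation matter. The condition 0 ≤ S accounts for an empty `s`. -/
lemma exists_bound_of_expFunctional {O : Set (Fin n → ℝ)} (V : ExpSpace O →L[ℂ] ℂ) :
    ∃ (s : Finset (CompactConvexIn O × ℕ)) (A : ℝ), 0 ≤ A ∧ ∀ (ψ : ExpSpace O) (S : ℝ), 0 ≤ S →
      (∀ i ∈ s, ∀ η, Real.exp (indicatorFn i.1.1 η) * ‖iteratedFDeriv ℝ i.2 ψ.fn η‖ ≤ S) →
        ‖V ψ‖ ≤ A * S := by
  obtain ⟨s, A, -, h⟩ := Seminorm.bound_of_continuous (expSeminorm_withSeminorms O)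
    ((normSeminorm ℂ ℂ).comp V.toLinearMap) (continuous_norm.comp V.continuous)
  refine ⟨s, A, A.2, fun ψ S hS hi => ?_⟩
  refine (h ψ).trans (mul_le_mul_of_nonneg_left ?_ A.2)
  refine Seminorm.finset_sup_apply_le hS fun i his => ?_
  exact ciSup_le fun η => hi i his η

lemma indicatorFn_le {K : Set (Fin n → ℝ)} {R : ℝ} (hR : 0 ≤ R) (hK : ∀ x ∈ K, l1 x ≤ R)
    (η : Fin n → ℝ) : indicatorFn K η ≤ R * ‖η‖ := by
  refine Real.sSup_le ?_ (by positivity)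
  rintro _ ⟨x, hx, rfl⟩
  have hcomm : pair x η = pair η x := by simp [pair, mul_comm]
  change |pair x η| ≤ _
  rw [hcomm, mul_comm]
  exact (abs_pair_le η x).trans (mul_le_mul_of_nonneg_left (hK x hx) (norm_nonneg η))

lemma exists_l1_bound {O : Set (Fin n → ℝ)} (K : CompactConvexIn O) :
    ∃ R : ℝ, 0 ≤ R ∧ ∀ x ∈ K.1, l1 x ≤ R := by
  obtain ⟨R, hR⟩ := K.2.1.exists_bound_of_continuousOn (f := l1) continuous_l1.continuousOn
  exact ⟨|R|, abs_nonneg R, fun x hx =>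
    (le_abs_self _).trans ((hR x hx).trans (le_abs_self R))⟩

/-- Makes the piece near the centre a legitimate argument of V. The indicator weight is replaced by
the larger, visibly continuous exp(R‖η‖). -/
lemma mem_expSubmodule_of_hasCompactSupport (O : Set (Fin n → ℝ)) {f : (Fin n → ℝ) → ℂ}
    (hf : ContDiff ℝ ∞ f) (hc : HasCompactSupport f) : f ∈ expSubmodule O := by
  refine ⟨hf, fun K m => ?_⟩
  obtain ⟨R, hR, hK⟩ := exists_l1_bound K
  have hcont : Continuous fun η => Real.exp (R * ‖η‖) • iteratedFDeriv ℝ m f η :=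
    (Real.continuous_exp.comp (continuous_const.mul continuous_norm)).smul (hf.continuous_iteratedFDeriv (by exact_mod_cast le_top))
  obtain ⟨M, hM⟩ := ((hc.iteratedFDeriv (𝕜 := ℝ) m).smul_left
    (f := fun η => Real.exp (R * ‖η‖))).exists_bound_of_continuous hcont
  refine ⟨M, fun η => le_trans ?_ (hM η)⟩
  change _ ≤ ‖Real.exp (R * ‖η‖) • iteratedFDeriv ℝ m f η‖
  rw [norm_smul, Real.norm_of_nonneg (Real.exp_pos _).le]
  exact mul_le_mul_of_nonneg_right (Real.exp_le_exp.2 (indicatorFn_le hR hK η)) (norm_nonneg _)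

/-- The wave front set of the tempered ultrahyperfunction associated with a distribution of
exponential growth. -/
theorem analyticWF_subset_of_isDualFourier {O C : Set (Fin n → ℝ)} {V : ExpSpace O →L[ℂ] ℂ}
    (hV : V ∈ ExpDualCone O C) {T : TemperedUltrahyperfunction n} (hT : IsDualFourier V T) :
    analyticWF T ⊆ univ ×ˢ dualCone C := by
  rintro ⟨x₀, ξ₀⟩ ⟨-, hWF⟩
  refine ⟨mem_univ _, ?_⟩
  by_contra hξ
  simp only [dualCone, mem_ofPred_eq, not_forall, not_le] at hξ
  obtain ⟨y, hy, hlt⟩ := hξ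
  obtain ⟨δ, hδ, hmem⟩ := exists_mem_negCone hlt
  obtain ⟨s, A, hA, hVb⟩ := exists_bound_of_expFunctional V
  obtain ⟨b, hb, hbc, hbs, hb1⟩ := exists_cutoff y hδ
  choose Rf hRf0 hRf using fun K : CompactConvexIn O => exists_l1_bound K
  -- Sums of nonnegative constants play the part of maxima over the finite set `s`, here and for
  -- `M`.
  set R : ℝ := ∑ i ∈ s, Rf i.1 with hR
  have hR0 : 0 ≤ R := Finset.sum_nonneg fun i _ => hRf0 i.1
  obtain ⟨κ, hκ, hdecay⟩ := exists_cutPacket_decay hb hbc hδ hb1 x₀ hR0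
  choose Mf hMf0 hMf using hdecay
  set M : ℝ := ∑ i ∈ s, Mf i.2 with hM
  have hM0 : 0 ≤ M := Finset.sum_nonneg fun i _ => hMf0 i.2
  -- Bounds the Gaussian prefactor (π/(κ‖ξ‖))^(n/2) for all ‖ξ‖ ≥ 1.
  set P : ℝ := ((Real.pi / κ) ^ (1 / 2 : ℝ)) ^ n with hP
  have hP0 : 0 ≤ P := pow_nonneg (Real.rpow_nonneg (by positivity) _) _
  refine hWF ⟨κ, hκ, Metric.ball x₀ 1, Metric.ball_mem_nhds _ one_pos, negCone y δ,
    isOpen_negCone y δ, isCone_negCone y δ, hmem,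
    ‖((2 * Real.pi : ℝ) : ℂ)⁻¹ ^ n‖ * (A * (P * M)), 1, one_pos, ?_⟩
  intro x hx ξ hΓ hξ1 h
  have hpos : 0 < euclid ξ := by linarith
  obtain ⟨ψ, hψ, hTψ⟩ := hT (packet (κ * euclid ξ) h x ξ)
  set a : ℂ := (((Real.pi / (κ * euclid ξ) : ℝ) : ℂ) ^ (1 / 2 : ℂ)) ^ n with ha
  have haP : ‖a‖ ≤ P := by
    rw [ha, norm_pow, Complex.norm_cpow_eq_rpow_re_of_pos (by positivity)]
    refine pow_le_pow_left₀ (Real.rpow_nonneg (by positivity) _) ?_ n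
    have e : ((1 / 2 : ℂ)).re = 1 / 2 := by norm_num
    rw [e]
    refine Real.rpow_le_rpow (by positivity) ?_ (by norm_num)
    exact div_le_div_of_nonneg_left Real.pi_pos.le hκ (by nlinarith)
  have hψ' : ψ.fn = fun η => a * Complex.exp (packetExponent (κ * euclid ξ) x ξ η) := by
    rw [hψ]
    exact funext fun η => fourier_packetFun h x ξ η
  have hbt : ContDiff ℝ ∞ fun η => b ((euclid ξ)⁻¹ • η) := hb.comp (contDiff_const_smul _)
  set g : (Fin n → ℝ) → ℂ := fun η => b ((euclid ξ)⁻¹ • η) • ψ.fn η with hg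
  have hgsub : tsupport g ⊆ (fun η => (euclid ξ)⁻¹ • η) ⁻¹' tsupport b := by
    refine closure_minimal ?_ ((isClosed_tsupport b).preimage (by fun_prop))
    intro η hη
    refine subset_tsupport b fun h0 => hη ?_
    change b _ • _ = (0 : ℂ)
    rw [h0, zero_smul]
  have hbcomp : HasCompactSupport fun η : Fin n → ℝ => b ((euclid ξ)⁻¹ • η) :=
    hbc.comp_homeomorph (Homeomorph.smulOfNeZero (euclid ξ)⁻¹ (inv_ne_zero hpos.ne'))
  have hgc : HasCompactSupport g := hbcomp.smul_right
  have hgmem : g ∈ expSubmodule O :=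
    mem_expSubmodule_of_hasCompactSupport O (hbt.smul ψ.mem.1) hgc
  let χ : ExpSpace O := (⟨g, hgmem⟩ : expSubmodule O)
  have hVχ : V χ = 0 := by
    -- On the support of `g` the pairing with y is at most -(δ/4)‖ξ‖, whereas y ∈ C pairs
    -- nonnegatively with C*.
    refine hV χ hgc (Set.disjoint_left.2 fun η hη hηC => ?_)
    have h1 : pair ((euclid ξ)⁻¹ • η) y ≤ -(δ / 4) := hbs (hgsub hη)
    rw [pair_smul_left] at h1
    have h2 : 0 ≤ pair η y := hηC y hy
    have h3 : 0 ≤ (euclid ξ)⁻¹ * pair η y := by positivity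
    linarith
  have hdiff : (ψ - χ).fn = a • cutPacket b (euclid ξ) (κ * euclid ξ) x ξ := by
    funext η
    change ψ.fn η - g η = a * cutPacket b (euclid ξ) (κ * euclid ξ) x ξ η
    simp only [hg, hψ', cutPacket, Complex.real_smul]
    push_cast
    ring
  have hcut : ContDiff ℝ ∞ (cutPacket b (euclid ξ) (κ * euclid ξ) x ξ) :=
    (contDiff_const.sub hbt).smul (Complex.contDiff_exp.comp (contDiff_packetExponent _ x ξ))
  have hVψ : ‖V ψ‖ ≤ A * (P * (M * Real.exp (-1 * euclid ξ))) := by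
    have e : V ψ = V (ψ - χ) := by rw [map_sub, hVχ, sub_zero]
    rw [e]
    refine hVb _ _ (by positivity) fun i hi η => ?_
    rw [hdiff, iteratedFDeriv_const_smul_apply (hcut.contDiffAt.of_le (by exact_mod_cast le_top)),
      norm_smul]
    have hRi : Rf i.1 ≤ R :=
      Finset.single_le_sum (f := fun i => Rf i.1) (fun i _ => hRf0 i.1) hi
    have hMi : Mf i.2 ≤ M :=
      Finset.single_le_sum (f := fun i => Mf i.2) (fun i _ => hMf0 i.2) hi
    have hind : indicatorFn i.1.1 η ≤ R * ‖η‖ :=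
      indicatorFn_le hR0 (fun x hx => (hRf i.1 x hx).trans hRi) η
    calc Real.exp (indicatorFn i.1.1 η) * (‖a‖ *
          ‖iteratedFDeriv ℝ i.2 (cutPacket b (euclid ξ) (κ * euclid ξ) x ξ) η‖)
        = ‖a‖ * (Real.exp (indicatorFn i.1.1 η) *
          ‖iteratedFDeriv ℝ i.2 (cutPacket b (euclid ξ) (κ * euclid ξ) x ξ) η‖) := by ring
      _ ≤ ‖a‖ * (Real.exp (R * ‖η‖) *
          ‖iteratedFDeriv ℝ i.2 (cutPacket b (euclid ξ) (κ * euclid ξ) x ξ) η‖) := by gcongr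
      _ ≤ P * (Mf i.2 * Real.exp (-1 * euclid ξ)) :=
          mul_le_mul haP (hMf i.2 x hx ξ hΓ hξ1 η) (by positivity) hP0
      _ ≤ _ := by gcongr
  rw [fbi, hTψ, norm_mul]
  calc _ ≤ ‖((2 * Real.pi : ℝ) : ℂ)⁻¹ ^ n‖ * (A * (P * (M * Real.exp (-1 * euclid ξ)))) :=
        mul_le_mul_of_nonneg_left hVψ (norm_nonneg _)
    _ = _ := by ring

end UHF

end

/-! ### Assembly of the two parts of the theorem -/

theorem mainTheorem4 (n : ℕ) (hn : 1 ≤ n) (C : Set (Fin n → ℝ))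
    (hopen : IsOpen C) (hconv : Convex ℝ C) (hcone : UHF.IsCone C) (hne : C.Nonempty)
    (hline : n = 1 → C ≠ Set.univ) :
    (∀ (u : UHF.UCone C) (f : UHF.HoloSpace C), (UHF.pseudoPart C).mkQ f = u →
      (∃! T : UHF.TemperedUltrahyperfunction n, UHF.Represents C f.1 T) ∧
      ∀ T : UHF.TemperedUltrahyperfunction n, UHF.Represents C f.1 T →
        UHF.analyticWF T ⊆ Set.univ ×ˢ UHF.dualCone C) ∧
    (∀ O : Set (Fin n → ℝ), IsOpen O → Convex ℝ O → O.Nonempty →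
      ∀ V ∈ UHF.ExpDualCone O C, ∀ T : UHF.TemperedUltrahyperfunction n,
        UHF.IsDualFourier V T → UHF.analyticWF T ⊆ Set.univ ×ˢ UHF.dualCone C) := by
  refine ⟨fun _ f _ => ⟨?_, fun T hT => ?_⟩, fun O _ _ _ V hV T hT => ?_⟩
  · exact UHF.existsUnique_represents hn hopen hconv hcone hne hline f
  · exact UHF.analyticWF_subset_of_represents hopen hcone f hT
  · exact UHF.analyticWF_subset_of_isDualFourier hV hT
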